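/- Let $I\subset\mathbb R$ be an interval with more than one point, and let $\mathcal S(t)=\partial\Omega(t)$, $t\in I$, be a closed (compact, boundaryless) smooth evolving surface in $\mathbb R^3$: each $\Omega(t)\subset\mathbb R^3$ is an open set with smooth compact boundary, and there are a closed smooth reference surface $\hat{\mathcal S}\subset\mathbb R^3$ (also the boundary of such an open set) and a map $\boldsymbol X\colon I\times\hat{\mathcal S}\to\mathbb R^3$, smooth in $(t,p)$, such that each $\boldsymbol X(t,\cdot)$ is a bijective immersion of $\hat{\mathcal S}$ onto $\mathcal S(t)$. Let $\boldsymbol\nu$ be the outer unit normal of $\mathcal S=\mathcal S(t)$, $\boldsymbol P=\boldsymbol I-\boldsymbol\nu\otimes\boldsymbol\nu$, and for a field $f$ on $\mathcal S$ put $\nabla_{C}f=(\nabla f^e)\boldsymbol P$, where $f^e$ is any differentiable extension of $f$. Let $\mathcal H=\operatorname{tr}(-\nabla_{C}\boldsymbol\nu)$ be the mean curvature. For a $C^1$ vector field $\boldsymbol u\colon\mathcal S\to\mathbb R^3$ let $\operatorname{div}_{P}\boldsymbol u=\operatorname{tr}(\boldsymbol P\,\nabla\boldsymbol u^e\,\boldsymbol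 P)$, and let $\operatorname{div}_{\mathcal S}$ be the covariant divergence of tangential fields on $\mathcal S$. Integrals over $\mathcal S$ are with respect to surface area. Let $\mathcal V(t)\colon\mathcal S(t)\to\mathbb R$, $t\in I$, be given functions. (1) Let $t\in I$, and suppose that there is a $C^1$ field $\boldsymbol u\colon\mathcal S(t)\to\mathbb R^3$ that is inextensible, $\operatorname{div}_{P}\boldsymbol u=0$ on $\mathcal S(t)$, and has the prescribed normal component $\boldsymbol u\cdot\boldsymbol\nu=\mathcal V$ on $\mathcal S(t)$. Then $\operatorname{div}_{\mathcal S}(\boldsymbol P\boldsymbol u)$ and $\mathcal V\mathcal H$ are integrable on $\mathcal S=\mathcal S(t)$ and $$0=\int_{\mathcal S}\operatorname{div}_{P}\boldsymbol u=\int_{\mathcal S}\big(\operatorname{div}_{\mathcal S}(\boldsymbol P\boldsymbol u)-\mathcal V\mathcal H\big)=-\int_{\mathcal S}\mathcal V\mathcal H .$$ Consequently $\mathcal V(t)\in\{v\in H^1(\mathcal S(t)) : \int_{\mathcal S(t)}v\,\mathcal H=0\}$. (2) The constraint expresses conservation of total area: if $\mathcal V$ is the normal velocity of the evolving surface, i.e.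 $\partial_t\boldsymbol X\cdot\boldsymbol\nu=\mathcal V$ on $\mathcal S(t)$ for all $t\in I$, then for every $t\in I$ the area $|\mathcal S(t)|$ is finite, $\mathcal V\mathcal H$ is integrable on $\mathcal S(t)$, and $$\frac{d}{dt}|\mathcal S(t)|=-\int_{\mathcal S(t)}\mathcal V\mathcal H$$ (one-sided derivative at an endpoint of $I$). In particular, if at every $t\in I$ there is a field $\boldsymbol u$ as in (1), then $|\mathcal S(t)|$ is constant on $I$. -/

import Mathlib

open MeasureTheory Set
open scoped ContDiff RealInnerProductSpace

noncomputable section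

/-- Euclidean three-space. -/
abbrev E3 : Type := EuclideanSpace ℝ (Fin 3)

namespace ClosedSurface

/-- `ρ` is a smooth regular defining function of `Ω` on the open neighbourhood `U` of `x`. -/
structure IsDefiningFunction (Ω : Set E3) (x : E3) (U : Set E3) (ρ : E3 → ℝ) : Prop where
  isOpen : IsOpen U
  mem : x ∈ U
  contDiffOn : ContDiffOn ℝ ∞ ρ U
  fderiv_ne_zero : ∀ y ∈ U, fderiv ℝ ρ y ≠ 0
  mem_iff : ∀ y ∈ U, y ∈ Ω ↔ ρ y < 0

/-- `Ω` is an open set with smooth boundary, lying locally on one side of its boundary, and the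
boundary surface `frontier Ω` is closed, i.e. compact (and without boundary). -/
structure IsSmoothDomain (Ω : Set E3) : Prop where
  isOpen : IsOpen Ω
  isCompact_frontier : IsCompact (frontier Ω)
  exists_definingFunction : ∀ x ∈ frontier Ω, ∃ U ρ, IsDefiningFunction Ω x U ρ

open Classical in
/-- The outer unit normal `ν = ∇ρ / |∇ρ|` of `Ω`. It does not depend on the chosen defining
function; values off `frontier Ω` are never used. -/
def normal (Ω : Set E3) (x : E3) : E3 :=
  if h : ∃ ρ : E3 → ℝ, ∃ U, IsDefiningFunction Ω x U ρ then
    ‖gradient h.choose x‖⁻¹ • gradient h.choose x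
  else 0

/-- The surface projection `P = I - ν ⊗ ν`. -/
def proj (Ω : Set E3) (x : E3) : E3 →L[ℝ] E3 :=
  ContinuousLinearMap.id ℝ E3 - (innerSL ℝ (normal Ω x)).smulRight (normal Ω x)

/-- The componentwise surface gradient `∇_C f = ∇fᵉ P` of a field `f` on `frontier Ω`.
`fderivWithin ℝ f (frontier Ω) x` is some linear map `A` with
`f y = f x + A (y - x) + o(|y - x|)` for `y` on the surface, for instance the derivative of any
differentiable extension `fᵉ` of `f`; all such `A` agree on the tangent plane, so that `A P` does
not depend on the choice and only involves the values of `f` on the surface. -/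
def gradC {F : Type*} [NormedAddCommGroup F] [NormedSpace ℝ F]
    (Ω : Set E3) (f : E3 → F) (x : E3) : E3 →L[ℝ] F :=
  (fderivWithin ℝ f (frontier Ω) x).comp (proj Ω x)

/-- The trace of an endomorphism of three-space. -/
def tr (A : E3 →L[ℝ] E3) : ℝ := LinearMap.trace ℝ E3 (A : E3 →ₗ[ℝ] E3)

/-- The surface tangential gradient `∇_P u = P ∇uᵉ P` of a (not necessarily tangential) field. -/
def gradP (Ω : Set E3) (u : E3 → E3) (x : E3) : E3 →L[ℝ] E3 :=
  (proj Ω x).comp (gradC Ω u x)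

/-- `div_P u = tr (∇_P u)`. -/
def divP (Ω : Set E3) (u : E3 → E3) (x : E3) : ℝ := tr (gradP Ω u x)

/-- `w` is a tangential vector field on the surface. -/
def IsTangential (Ω : Set E3) (w : E3 → E3) : Prop :=
  ∀ x ∈ frontier Ω, ⟪w x, normal Ω x⟫ = 0

/-- The covariant derivative (Levi-Civita connection of the induced metric) of a tangential field
`w`: `∇_v w` is the tangential part of the derivative of `w` in the tangential direction `v`;
extended by zero to the normal direction. -/
def covDeriv (Ω : Set E3) (w : E3 → E3) (x : E3) : E3 →L[ℝ] E3 :=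
  (proj Ω x).comp ((fderivWithin ℝ w (frontier Ω) x).comp (proj Ω x))

/-- The covariant divergence `div_S w` of a tangential field `w`. -/
def divS (Ω : Set E3) (w : E3 → E3) (x : E3) : ℝ := tr (covDeriv Ω w x)

/-- The tangential part `P u` of a vector field. -/
def tangentialPart (Ω : Set E3) (u : E3 → E3) (x : E3) : E3 := proj Ω x (u x)

/-- The shape operator `B = -∇_C ν`. -/
def shapeOperator (Ω : Set E3) (x : E3) : E3 →L[ℝ] E3 := -gradC Ω (normal Ω) x

/-- The mean curvature `H = tr B`. -/
def meanCurvature (Ω : Set E3) (x : E3) : ℝ := tr (shapeOperator Ω x)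

/-- The surface measure: two-dimensional Hausdorff measure (normalised to agree with Lebesgue
measure on planes) restricted to the surface. -/
def surfaceMeasure (Ω : Set E3) : Measure E3 :=
  (Measure.euclideanHausdorffMeasure 2 : Measure E3).restrict (frontier Ω)

/-- The total area of the surface, as an extended nonnegative number. -/
def area (Ω : Set E3) : ENNReal := surfaceMeasure Ω univ

/-- `v ∈ H¹(S)`: `v` is square integrable on the surface and has a square integrable weak
tangential gradient `g`. -/
def MemH1 (Ω : Set E3) (v : E3 → ℝ) : Prop :=
  MemLp v 2 (surfaceMeasure Ω) ∧
    ∃ g : E3 → E3, MemLp g 2 (surfaceMeasure Ω) ∧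
      (∀ᵐ x ∂surfaceMeasure Ω, ⟪g x, normal Ω x⟫ = 0) ∧
      ∀ w : E3 → E3, ContDiffOn ℝ ∞ w (frontier Ω) → IsTangential Ω w →
        ∫ x, v x * divS Ω w x ∂surfaceMeasure Ω = -∫ x, ⟪g x, w x⟫ ∂surfaceMeasure Ω

/-- `u` is a continuously differentiable inextensible velocity field on the surface
`frontier Ω` with prescribed normal component `v`. -/
structure IsInextensibleVelocity (Ω : Set E3) (v : E3 → ℝ) (u : E3 → E3) : Prop where
  contDiffOn : ContDiffOn ℝ 1 u (frontier Ω)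
  divP_eq_zero : ∀ x ∈ frontier Ω, divP Ω u x = 0
  inner_normal : ∀ x ∈ frontier Ω, ⟪u x, normal Ω x⟫ = v x

/-- The boundaries `frontier (Ω t)`, `t ∈ I`, form a closed smooth evolving surface with
parametrization `X`: over a closed smooth reference surface `frontier Ωref`, `X` is jointly smooth
in time and space, and each `X t` is a bijective immersion onto `frontier (Ω t)`. -/
structure IsEvolvingSurface (I : Set ℝ) (Ωref : Set E3) (Ω : ℝ → Set E3) (X : ℝ → E3 → E3) :
    Prop where
  reference : IsSmoothDomain Ωref
  domain : ∀ t ∈ I, IsSmoothDomain (Ω t)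
  contDiffOn : ContDiffOn ℝ ∞ (fun q : ℝ × E3 => X q.1 q.2) (I ×ˢ frontier Ωref)
  bijOn : ∀ t ∈ I, BijOn (X t) (frontier Ωref) (frontier (Ω t))
  immersion : ∀ t ∈ I, ∀ p ∈ frontier Ωref, ∀ z : E3, ⟪z, normal Ωref p⟫ = 0 →
    gradC Ωref (X t) p z = 0 → z = 0

/-- The evolving surface moves with normal velocity `V`, i.e. `∂ₜX · ν = V`. -/
def HasNormalVelocity (I : Set ℝ) (Ωref : Set E3) (Ω : ℝ → Set E3) (X : ℝ → E3 → E3)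
    (V : ℝ → E3 → ℝ) : Prop :=
  ∀ t ∈ I, ∀ p ∈ frontier Ωref,
    ⟪derivWithin (fun s => X s p) I t, normal (Ω t) (X t p)⟫ = V t (X t p)

end ClosedSurface

namespace ClosedSurface
open Filter Topology

theorem IsDefiningFunction.differentiableAt {Ω : Set E3} {x : E3} {U : Set E3} {ρ : E3 → ℝ}
    (h : IsDefiningFunction Ω x U ρ) {y : E3} (hy : y ∈ U) : DifferentiableAt ℝ ρ y :=
  (h.contDiffOn.contDiffAt (h.isOpen.mem_nhds hy)).differentiableAt (by simp)

/-- In the domain of a defining function, the surface is its zero set. -/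
theorem IsDefiningFunction.mem_frontier_iff {Ω : Set E3} (hΩ : IsOpen Ω) {x : E3} {U : Set E3}
    {ρ : E3 → ℝ} (h : IsDefiningFunction Ω x U ρ) {y : E3} (hy : y ∈ U) :
    y ∈ frontier Ω ↔ ρ y = 0 := by
  have hU : U ∈ 𝓝 y := h.isOpen.mem_nhds hy
  have hc : ContinuousAt ρ y := (h.differentiableAt hy).continuousAt
  rw [hΩ.frontier_eq, Set.mem_sdiff, h.mem_iff y hy]
  constructor
  · rintro ⟨h1, h2⟩
    by_contra h3
    have h4 : ∀ᶠ z in 𝓝 y, 0 < ρ z := hc.eventually (lt_mem_nhds (by grind))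
    obtain ⟨z, hz, hz'⟩ := (mem_closure_iff_frequently.1 h1).and_eventually (h4.and hU) |>.exists
    have := (h.mem_iff z hz'.2).1 hz
    linarith [hz'.1]
  · intro h0
    refine ⟨?_, by simp [h0]⟩
    by_contra h1
    rw [mem_closure_iff_frequently, not_frequently] at h1
    refine h.fderiv_ne_zero y hy (IsLocalMin.fderiv_eq_zero ?_)
    filter_upwards [h1, hU] with z hz hzU
    rw [h.mem_iff z hzU] at hz
    rw [h0]
    exact not_lt.1 hz

/-- The outer unit normal can be computed with any defining function. -/
theorem normal_eq {Ω : Set E3} (hΩ : IsOpen Ω) {x : E3} (hx : x ∈ frontier Ω) {U : Set E3}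
    {ρ : E3 → ℝ} (h : IsDefiningFunction Ω x U ρ) :
    normal Ω x = ‖gradient ρ x‖⁻¹ • gradient ρ x := by
  have hex : ∃ ρ : E3 → ℝ, ∃ U, IsDefiningFunction Ω x U ρ := ⟨ρ, U, h⟩
  rw [normal, dif_pos hex]
  obtain ⟨W, h'⟩ := hex.choose_spec
  generalize hex.choose = σ at h'
  have key : ∀ v : E3, fderiv ℝ ρ x v < 0 → fderiv ℝ σ x v ≤ 0 := by
    intro v hv
    by_contra! hv'
    have hline : HasDerivAt (fun s : ℝ => x + s • v) v 0 := by
      simpa using ((hasDerivAt_id (0 : ℝ)).smul_const v).const_add x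
    have hl0 : x + (0 : ℝ) • v = x := by simp
    have d1 : HasDerivAt (fun s : ℝ => ρ (x + s • v)) (fderiv ℝ ρ x v) 0 := by
      have := (h.differentiableAt h.mem).hasFDerivAt
      exact HasFDerivAt.comp_hasDerivAt_of_eq (0 : ℝ) this hline hl0.symm
    have d2 : HasDerivAt (fun s : ℝ => σ (x + s • v)) (fderiv ℝ σ x v) 0 := by
      have := (h'.differentiableAt h'.mem).hasFDerivAt
      exact HasFDerivAt.comp_hasDerivAt_of_eq (0 : ℝ) this hline hl0.symm
    have z1 : ρ x = 0 := (h.mem_frontier_iff hΩ h.mem).1 hx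
    have z2 : σ x = 0 := (h'.mem_frontier_iff hΩ h'.mem).1 hx
    have e1 := (hasDerivWithinAt_iff_tendsto_slope' (s := Ioi (0 : ℝ)) (by simp)).1
      d1.hasDerivWithinAt |>.eventually (gt_mem_nhds hv)
    have e2 := (hasDerivWithinAt_iff_tendsto_slope' (s := Ioi (0 : ℝ)) (by simp)).1
      d2.hasDerivWithinAt |>.eventually (lt_mem_nhds hv')
    have hcont : Tendsto (fun s : ℝ => x + s • v) (𝓝[>] 0) (𝓝 x) := by
      have := hline.continuousAt.tendsto
      rw [hl0] at this
      exact this.mono_left nhdsWithin_le_nhds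
    have hev := hcont.eventually ((h.isOpen.mem_nhds h.mem) : U ∈ 𝓝 x)
    have hev' := hcont.eventually ((h'.isOpen.mem_nhds h'.mem) : W ∈ 𝓝 x)
    obtain ⟨s, a1, a2, a3, a4, a5⟩ :=
      (e1.and (e2.and (hev.and (hev'.and self_mem_nhdsWithin)))).exists
    simp only [slope_def_field, hl0, z1, z2, sub_zero] at a1 a2 a5
    have b1 : ρ (x + s • v) < 0 := by
      by_contra! hb
      exact absurd a1 (not_lt.2 (div_nonneg hb a5.le))
    have b2 : 0 < σ (x + s • v) := by
      by_contra! hb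
      exact absurd a2 (not_lt.2 (div_nonpos_of_nonpos_of_nonneg hb a5.le))
    have := (h'.mem_iff _ a4).1 ((h.mem_iff _ a3).2 b1)
    linarith
  have g1 : ∀ v, fderiv ℝ ρ x v = ⟪gradient ρ x, v⟫ := fun v => by simp [gradient]
  have g2 : ∀ v, fderiv ℝ σ x v = ⟪gradient σ x, v⟫ := fun v => by simp [gradient]
  have n1 : gradient ρ x ≠ 0 := by simpa [gradient] using h.fderiv_ne_zero x h.mem
  have n2 : gradient σ x ≠ 0 := by simpa [gradient] using h'.fderiv_ne_zero x h'.mem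
  simp only [g1, g2] at key
  generalize gradient ρ x = a at *
  generalize gradient σ x = b at *
  have ha : 0 < ‖a‖ := norm_pos_iff.2 n1
  have hb : 0 < ‖b‖ := norm_pos_iff.2 n2
  have ua : ‖‖a‖⁻¹ • a‖ = 1 := by rw [norm_smul]; simp [ha.ne']
  have ub : ‖‖b‖⁻¹ • b‖ = 1 := by rw [norm_smul]; simp [hb.ne']
  by_contra hne
  have hlt : ⟪‖a‖⁻¹ • a, ‖b‖⁻¹ • b⟫ < 1 :=
    inner_lt_one_iff_real_of_norm_eq_one ua ub |>.2 (Ne.symm hne)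
  have k1 : ⟪a, ‖b‖⁻¹ • b - ‖a‖⁻¹ • a⟫ < 0 := by
    have : ⟪‖a‖⁻¹ • a, ‖b‖⁻¹ • b - ‖a‖⁻¹ • a⟫ < 0 := by
      rw [inner_sub_right, real_inner_self_eq_norm_sq (‖a‖⁻¹ • a), ua]; linarith
    rw [real_inner_smul_left] at this
    by_contra! hc
    exact absurd this (not_lt.2 (mul_nonneg (inv_nonneg.2 ha.le) hc))
  have k2 := key _ k1
  have k3 : 0 < ⟪‖b‖⁻¹ • b, ‖b‖⁻¹ • b - ‖a‖⁻¹ • a⟫ := by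
    rw [inner_sub_right, real_inner_self_eq_norm_sq (‖b‖⁻¹ • b), ub, real_inner_comm]; linarith
  rw [real_inner_smul_left] at k3
  exact absurd k3 (not_lt.2 (mul_nonpos_of_nonneg_of_nonpos (inv_nonneg.2 hb.le) k2))

/-- The surface gradient can be computed with any derivative along the surface, in particular with
the derivative of any extension. -/
theorem gradC_eq {F : Type*} [NormedAddCommGroup F] [NormedSpace ℝ F] {Ω : Set E3}
    (hΩ : IsSmoothDomain Ω) {f : E3 → F} {x : E3} (hx : x ∈ frontier Ω) {A : E3 →L[ℝ] F}
    (hA : HasFDerivWithinAt f A (frontier Ω) x) : gradC Ω f x = A.comp (proj Ω x) := by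
  obtain ⟨U, ρ, h⟩ := hΩ.exists_definingFunction x hx
  have hU : U ∈ 𝓝 x := h.isOpen.mem_nhds h.mem
  have hs : HasStrictFDerivAt ρ (fderiv ℝ ρ x) x :=
    (h.contDiffOn.contDiffAt hU).hasStrictFDerivAt (by simp)
  have hr : (fderiv ℝ ρ x).range = ⊤ := by
    rw [LinearMap.range_eq_top]
    refine LinearMap.surjective (f := (fderiv ℝ ρ x : E3 →ₗ[ℝ] ℝ)) fun h0 => ?_
    exact h.fderiv_ne_zero x h.mem (ContinuousLinearMap.coe_injective h0)
  have z : ρ x = 0 := (h.mem_frontier_iff hΩ.isOpen h.mem).1 hx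
  have tang : ∀ v : E3, fderiv ℝ ρ x v = 0 → fderivWithin ℝ f (frontier Ω) x v = A v := by
    intro v hv
    let γ : (fderiv ℝ ρ x).ker → E3 := hs.implicitFunction ρ (fderiv ℝ ρ x) hr (ρ x)
    have hγ0 : γ 0 = x := hs.implicitFunction_apply_image hr
    have hγ : HasStrictFDerivAt γ (fderiv ℝ ρ x).ker.subtypeL 0 := hs.to_implicitFunction hr
    have hmem : ∀ᶠ k in 𝓝 (0 : (fderiv ℝ ρ x).ker), γ k ∈ frontier Ω := by
      have e1 := hs.map_implicitFunction_eq hr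
      have e2 : Tendsto (fun k : (fderiv ℝ ρ x).ker => (ρ x, k)) (𝓝 0) (𝓝 (ρ x, 0)) :=
        (Continuous.prodMk_right (ρ x)).tendsto 0
      have e3 : Tendsto γ (𝓝 0) (𝓝 x) := by
        simpa only [hγ0] using hγ.continuousAt.tendsto
      filter_upwards [e2.eventually e1, e3.eventually hU] with k hk hkU
      exact (h.mem_frontier_iff hΩ.isOpen hkU).2 (hk.trans z)
    have push : ∀ B : E3 →L[ℝ] F, HasFDerivWithinAt f B (frontier Ω) x →
        HasFDerivAt (f ∘ γ) (B.comp (fderiv ℝ ρ x).ker.subtypeL) 0 := by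
      intro B hB
      rw [← hγ0] at hB
      exact hB.comp_hasFDerivAt (0 : (fderiv ℝ ρ x).ker) hγ.hasFDerivAt hmem
    have := (push _ hA.differentiableWithinAt.hasFDerivWithinAt).unique (push _ hA)
    exact congrArg (fun L => L ⟨v, hv⟩) this
  have n1 : gradient ρ x ≠ 0 := by simpa [gradient] using h.fderiv_ne_zero x h.mem
  have ha : 0 < ‖gradient ρ x‖ := norm_pos_iff.2 n1
  ext v
  refine tang _ ?_
  have g1 : ∀ v, fderiv ℝ ρ x v = ⟪gradient ρ x, v⟫ := fun v => by simp [gradient]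
  rw [g1]
  have e : proj Ω x v = v - ⟪normal Ω x, v⟫ • normal Ω x := rfl
  change ⟪gradient ρ x, proj Ω x v⟫ = 0
  rw [e, normal_eq hΩ.isOpen hx h]
  simp only [inner_sub_right, real_inner_smul_left, real_inner_smul_right,
    real_inner_self_eq_norm_sq]
  field_simp
  ring

end ClosedSurface

end

open MeasureTheory Set
open scoped ContDiff RealInnerProductSpace

noncomputable section

namespace ClosedSurface
open Filter Topology

/-! Everything rests on one pointwise identity, div_P u = div_S(Pu) - (u·ν) H (`divP_eq_divS_sub`),
and on the divergence theorem on a closed surface. Together they give ∫ div_P u = -∫ (u·ν) H for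
every C¹ field u (`integral_divP`). For an inextensible field the left side is zero, which is the
constraint. Membership in H¹ holds because V = u·ν is C¹ on the surface: the divergence theorem
applied to v w shows that the classical tangential gradient of v is also a weak one.

A partition of unity reduces the divergence theorem to fields supported in one chart φ. Write φ₀, φ₁
for the partial derivatives, J = |φ₀ × φ₁| and N = (φ₀ × φ₁)/J. Then J div_S w = ∂₀⟨N, w × φ₁⟩ +
∂₁⟨N, φ₀ × w⟩, and compactly supported planar derivatives integrate to zero. Since surface area is
Hausdorff measure, passing to coordinates needs the area formula `IsImmersedPatch.area_image`.

For the area, all surfaces S(t) are pulled back to the charts of the fixed reference surface, and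
the area element is differentiated under the integral. Mixed derivatives commute, so ∂ₜφᵢ = A φᵢ
with A a derivative of the velocity along S(t), and `inner_crossL_map_add_eq_tr` gives ∂ₜJ = J
div_P(velocity). Hence d|S|/dt = ∫ div_P(velocity) = -∫ V H. If this vanishes throughout I, the area
is constant.

A derivative along the surface is unique only on the tangent plane. Regularity and linearity are
therefore proved for its composite with P, by way of `gradC_eq`. -/

/-- The Euclidean plane. -/
abbrev E2 : Type := EuclideanSpace ℝ (Fin 2)

/-! ### Linear algebra: cross products and traces -/

/-- The cross product on Euclidean three-space, as a continuous bilinear map. -/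
def crossL : E3 →L[ℝ] E3 →L[ℝ] E3 :=
  LinearMap.toContinuousBilinearMap (LinearMap.mk₂ ℝ
    (fun a b : E3 => (!₂[a 1 * b 2 - a 2 * b 1, a 2 * b 0 - a 0 * b 2, a 0 * b 1 - a 1 * b 0] : E3))
    (fun a a' b => by ext i; fin_cases i <;> simp <;> ring)
    (fun c a b => by ext i; fin_cases i <;> simp <;> ring)
    (fun a b b' => by ext i; fin_cases i <;> simp <;> ring)
    (fun c a b => by ext i; fin_cases i <;> simp <;> ring))

theorem crossL_apply (a b : E3) : crossL a b =
    !₂[a 1 * b 2 - a 2 * b 1, a 2 * b 0 - a 0 * b 2, a 0 * b 1 - a 1 * b 0] := rfl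

theorem crossL_apply_zero (a b : E3) : crossL a b 0 = a 1 * b 2 - a 2 * b 1 := rfl
theorem crossL_apply_one (a b : E3) : crossL a b 1 = a 2 * b 0 - a 0 * b 2 := rfl
theorem crossL_apply_two (a b : E3) : crossL a b 2 = a 0 * b 1 - a 1 * b 0 := rfl

theorem inner_eq_coord (a b : E3) : ⟪a, b⟫ = a 0 * b 0 + a 1 * b 1 + a 2 * b 2 := by
  simp [PiLp.inner_apply, Fin.sum_univ_three, mul_comm]

theorem inner_crossL_eq_coord (a b c : E3) : ⟪a, crossL b c⟫ =
    a 0 * (b 1 * c 2 - b 2 * c 1) + a 1 * (b 2 * c 0 - b 0 * c 2)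
      + a 2 * (b 0 * c 1 - b 1 * c 0) := by
  rw [inner_eq_coord, crossL_apply]; simp

theorem norm_crossL_sq (a b : E3) : ‖crossL a b‖ ^ 2 = ‖a‖ ^ 2 * ‖b‖ ^ 2 - ⟪a, b⟫ ^ 2 := by
  simp only [← real_inner_self_eq_norm_sq, inner_eq_coord, crossL_apply_zero, crossL_apply_one,
    crossL_apply_two]
  ring

theorem crossL_swap (a b : E3) : crossL a b = -crossL b a := by
  ext i; fin_cases i <;> simp [crossL_apply] <;> ring

/-- Three vectors in a common plane have vanishing triple product. -/
theorem inner_crossL_eq_zero {N a b c : E3} (hN : N ≠ 0) (ha : ⟪a, N⟫ = 0) (hb : ⟪b, N⟫ = 0)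
    (hc : ⟪c, N⟫ = 0) : ⟪a, crossL b c⟫ = 0 := by
  -- This is Cramer's identity det(a,b,c) N = ⟨a,N⟩ b×c + ⟨b,N⟩ c×a + ⟨c,N⟩ a×b, paired with N.
  have h : ⟪a, crossL b c⟫ * ⟪N, N⟫ = ⟪a, N⟫ * ⟪N, crossL b c⟫ + ⟪b, N⟫ * ⟪N, crossL c a⟫
      + ⟪c, N⟫ * ⟪N, crossL a b⟫ := by
    simp only [inner_eq_coord, crossL_apply_zero, crossL_apply_one, crossL_apply_two]; ring
  rw [ha, hb, hc] at h
  simpa [hN] using h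

/-- A vector orthogonal to the plane spanned by `a`, `b` is a multiple of the unit normal. -/
theorem eq_inner_smul_of_orthogonal {ν a b : E3} (hν : ‖ν‖ = 1) (ha : ⟪a, ν⟫ = 0)
    (hb : ⟪b, ν⟫ = 0) : crossL a b = ⟪ν, crossL a b⟫ • ν := by
  have h1 : ⟪ν, ν⟫ = 1 := by rw [real_inner_self_eq_norm_sq, hν]; norm_num
  rw [inner_eq_coord] at ha hb h1
  rw [inner_crossL_eq_coord]
  ext i
  fin_cases i
  · simp [crossL_apply]
    linear_combination (-(a 1 * b 2 - a 2 * b 1)) * h1 + (ν 1 * b 2 - ν 2 * b 1) * ha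
      + (ν 2 * a 1 - ν 1 * a 2) * hb
  · simp [crossL_apply]
    linear_combination (-(a 2 * b 0 - a 0 * b 2)) * h1 + (ν 2 * b 0 - ν 0 * b 2) * ha
      + (ν 0 * a 2 - ν 2 * a 0) * hb
  · simp [crossL_apply]
    linear_combination (-(a 0 * b 1 - a 1 * b 0)) * h1 + (ν 0 * b 1 - ν 1 * b 0) * ha
      + (ν 1 * a 0 - ν 0 * a 1) * hb

theorem tr_eq_sum (A : E3 →L[ℝ] E3) : tr A = ∑ i, A (EuclideanSpace.single i 1) i := by
  rw [tr, LinearMap.trace_eq_sum_inner _ (EuclideanSpace.basisFun (Fin 3) ℝ)]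
  simp [EuclideanSpace.inner_single_left]

theorem tr_add (A B : E3 →L[ℝ] E3) : tr (A + B) = tr A + tr B := by simp [tr]
theorem tr_neg (A : E3 →L[ℝ] E3) : tr (-A) = -tr A := by simp [tr]
theorem tr_smulRight (ℓ : E3 →L[ℝ] ℝ) (v : E3) : tr (ℓ.smulRight v) = ℓ v := by
  rw [tr_eq_sum]
  conv_rhs => rw [← (EuclideanSpace.basisFun (Fin 3) ℝ).sum_repr v, map_sum]
  simp [mul_comm]

theorem continuous_tr : Continuous tr := by
  simp only [funext tr_eq_sum]
  fun_prop

theorem apply_eq_coord (A : E3 →L[ℝ] E3) (v : E3) (i : Fin 3) :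
    A v i = ∑ j, v j * A (EuclideanSpace.single j 1) i := by
  conv_lhs => rw [← (EuclideanSpace.basisFun (Fin 3) ℝ).sum_repr v, map_sum]
  simp

/-- With n = a × b this is the trace identity det(An,a,b) + det(n,Aa,b) + det(n,a,Ab) = tr A ·
det(n,a,b), where det(n,a,b) = |n|² and det(An,a,b) = ⟨n, An⟩. -/
theorem inner_crossL_map_add (A : E3 →L[ℝ] E3) (a b : E3) :
    ⟪crossL a b, crossL (A a) b⟫ + ⟪crossL a b, crossL a (A b)⟫ =
      ‖crossL a b‖ ^ 2 * tr A - ⟪crossL a b, A (crossL a b)⟫ := by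
  rw [← real_inner_self_eq_norm_sq]
  simp only [inner_eq_coord, tr_eq_sum, apply_eq_coord A (crossL a b), apply_eq_coord A a,
    apply_eq_coord A b, Fin.sum_univ_three, crossL_apply_zero, crossL_apply_one, crossL_apply_two]
  ring

theorem proj_apply (Ω : Set E3) (x v : E3) :
    proj Ω x v = v - ⟪normal Ω x, v⟫ • normal Ω x := rfl

/-- Cyclicity of the trace and P² = P. This reconciles the mean curvature, defined with a single P,
with the two-sided projection in `divP`. -/
theorem tr_proj_comp_comp_proj {Ω : Set E3} {x : E3} (h : ‖normal Ω x‖ = 1) (A : E3 →L[ℝ] E3) :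
    tr ((proj Ω x).comp (A.comp (proj Ω x))) = tr (A.comp (proj Ω x)) := by
  have h1 : ⟪normal Ω x, normal Ω x⟫ = 1 := by rw [real_inner_self_eq_norm_sq, h]; norm_num
  have hP : (proj Ω x).comp (proj Ω x) = proj Ω x := by
    ext1 v
    simp only [ContinuousLinearMap.comp_apply, proj_apply, inner_sub_right, real_inner_smul_right]
    rw [h1]; simp
  refine (LinearMap.trace_mul_comm ℝ (proj Ω x : E3 →ₗ[ℝ] E3)
    (A.comp (proj Ω x) : E3 →L[ℝ] E3)).trans ?_
  conv_rhs => rw [← hP]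
  rfl

theorem tr_proj_comp_proj {Ω : Set E3} {x : E3} (h : ‖normal Ω x‖ = 1) (A : E3 →L[ℝ] E3) :
    tr ((proj Ω x).comp (A.comp (proj Ω x))) = tr A - ⟪normal Ω x, A (normal Ω x)⟫ := by
  rw [tr_proj_comp_comp_proj h]
  have : A.comp (proj Ω x) = A + -((innerSL ℝ (normal Ω x)).smulRight (A (normal Ω x))) := by
    ext1 v
    simp [proj_apply, sub_eq_add_neg]
  rw [this, tr_add, tr_neg, tr_smulRight]
  simp [sub_eq_add_neg]

/-- The derivative of the area element of the plane spanned by `a`, `b` is the surface trace. -/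
theorem inner_crossL_map_add_eq_tr {Ω : Set E3} {x : E3} (h : ‖normal Ω x‖ = 1)
    (A : E3 →L[ℝ] E3) {a b : E3} (ha : ⟪a, normal Ω x⟫ = 0) (hb : ⟪b, normal Ω x⟫ = 0) :
    ⟪crossL a b, crossL (A a) b⟫ + ⟪crossL a b, crossL a (A b)⟫ =
      ‖crossL a b‖ ^ 2 * tr ((proj Ω x).comp (A.comp (proj Ω x))) := by
  rw [inner_crossL_map_add, tr_proj_comp_proj h]
  have e := eq_inner_smul_of_orthogonal h ha hb
  set c := ⟪normal Ω x, crossL a b⟫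
  have e2 : ⟪crossL a b, A (crossL a b)⟫ = c ^ 2 * ⟪normal Ω x, A (normal Ω x)⟫ := by
    rw [e]; simp [real_inner_smul_left, real_inner_smul_right]; ring
  have e3 : ‖crossL a b‖ ^ 2 = c ^ 2 := by
    rw [e, norm_smul, h]; simp
  rw [e2, e3]; ring

/-! ### The area formula for immersed patches -/

theorem normDet_eq_norm_crossL (L : E2 →L[ℝ] E3) :
    LinearMap.normDet (L : E2 →ₗ[ℝ] E3) =
      ‖crossL (L (EuclideanSpace.single 0 1)) (L (EuclideanSpace.single 1 1))‖ := by
  have h := LinearMap.normDet_sq_eq_det_gram (L : E2 →ₗ[ℝ] E3) (EuclideanSpace.basisFun (Fin 2) ℝ)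
  rw [← pow_left_inj₀ (LinearMap.normDet_nonneg _) (norm_nonneg _) two_ne_zero, norm_crossL_sq]
  simp [Matrix.det_fin_two, Matrix.gram] at h
  rw [h, real_inner_comm]; ring

/-- Area comparison: if distances between values of `f` are at most `K` times those between values
of `g`, then areas of images grow at most by the factor `K ^ 2`. -/
theorem euclideanHausdorffMeasure_image_le {f g : E2 → E3} {A : Set E2} {K : NNReal}
    (hg : InjOn g A)
    (h : ∀ y ∈ A, ∀ z ∈ A, dist (f y) (f z) ≤ K * dist (g y) (g z)) :
    (Measure.euclideanHausdorffMeasure 2 : Measure E3) (f '' A) ≤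
      (K : ENNReal) ^ 2 * (Measure.euclideanHausdorffMeasure 2 : Measure E3) (g '' A) := by
  -- The hypothesis says that f ∘ g⁻¹ is K-Lipschitz on g(A), and a K-Lipschitz map enlarges
  -- two-dimensional Hausdorff measure at most by K².
  have hlip : LipschitzOnWith K (f ∘ Function.invFunOn g A) (g '' A) := by
    refine LipschitzOnWith.of_dist_le_mul ?_
    rintro _ ⟨y, hy, rfl⟩ _ ⟨z, hz, rfl⟩
    simp only [Function.comp_apply, hg.leftInvOn_invFunOn hy, hg.leftInvOn_invFunOn hz]
    exact h y hy z hz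
  have him : f '' A = (f ∘ Function.invFunOn g A) '' (g '' A) := by
    rw [image_image]
    refine image_congr fun y hy => ?_
    simp only [Function.comp_apply, hg.leftInvOn_invFunOn hy]
  have key := hlip.hausdorffMeasure_image_le (d := 2) (by norm_num)
  rw [← him] at key
  simp only [Measure.euclideanHausdorffMeasure_def, Measure.smul_apply, Nat.cast_ofNat]
  rw [ENNReal.smul_def, ENNReal.smul_def, smul_eq_mul, smul_eq_mul, mul_left_comm]
  gcongr
  simpa using key

theorem euclideanHausdorffMeasure_image_linear (L : E2 →L[ℝ] E3) (A : Set E2) :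
    (Measure.euclideanHausdorffMeasure 2 : Measure E3) (L '' A) =
      ENNReal.ofReal (LinearMap.normDet (L : E2 →ₗ[ℝ] E3)) * volume A := by
  have h := LinearMap.euclideanHausdorffMeasure_image_eq_normDet_mul_volume (L : E2 →ₗ[ℝ] E3) A
  simpa using h

theorem continuous_normDet :
    Continuous fun L : E2 →L[ℝ] E3 => LinearMap.normDet (L : E2 →ₗ[ℝ] E3) := by
  simp only [normDet_eq_norm_crossL]
  fun_prop

theorem normDet_pos {L : E2 →L[ℝ] E3} (h : Function.Injective L) :
    0 < LinearMap.normDet (L : E2 →ₗ[ℝ] E3) := by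
  refine lt_of_le_of_ne (LinearMap.normDet_nonneg _) (Ne.symm fun h0 => ?_)
  rw [LinearMap.normDet_eq_zero_iff_ker_ne_bot] at h0
  exact h0 (LinearMap.ker_eq_bot.2 h)

theorem disjoint_image_iff_of_injOn {α β : Type*} {f : α → β} {W C D : Set α} (h : InjOn f W)
    (hC : C ⊆ W) (hD : D ⊆ W) : Disjoint (f '' C) (f '' D) ↔ Disjoint C D := by
  rw [disjoint_iff_inter_eq_empty, disjoint_iff_inter_eq_empty, ← h.image_inter hC hD,
    image_eq_empty]

/-- A continuously differentiable injective immersion of an open subset of the plane. -/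
structure IsImmersedPatch (W : Set E2) (φ : E2 → E3) : Prop where
  isOpen : IsOpen W
  contDiffOn : ContDiffOn ℝ 1 φ W
  injOn : InjOn φ W
  injective : ∀ y ∈ W, Function.Injective (fderiv ℝ φ y)

/-- The area element of a patch. -/
def areaElement (φ : E2 → E3) (y : E2) : ℝ := LinearMap.normDet (fderiv ℝ φ y : E2 →ₗ[ℝ] E3)

theorem areaElement_eq (φ : E2 → E3) (y : E2) : areaElement φ y =
    ‖crossL (fderiv ℝ φ y (EuclideanSpace.single 0 1))
      (fderiv ℝ φ y (EuclideanSpace.single 1 1))‖ := normDet_eq_norm_crossL _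

namespace IsImmersedPatch
variable {W : Set E2} {φ : E2 → E3}

theorem hasStrictFDerivAt (h : IsImmersedPatch W φ) {y : E2} (hy : y ∈ W) :
    HasStrictFDerivAt φ (fderiv ℝ φ y) y :=
  (h.contDiffOn.contDiffAt (h.isOpen.mem_nhds hy)).hasStrictFDerivAt (by simp)

theorem continuousOn_areaElement (h : IsImmersedPatch W φ) : ContinuousOn (areaElement φ) W :=
  continuous_normDet.comp_continuousOn (h.contDiffOn.continuousOn_fderiv_of_isOpen h.isOpen le_rfl)

theorem areaElement_pos (h : IsImmersedPatch W φ) {y : E2} (hy : y ∈ W) : 0 < areaElement φ y :=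
  normDet_pos (h.injective y hy)

/-- Locally, a patch distorts distances like its derivative, up to a factor `K`. -/
theorem eventually_dist_le (h : IsImmersedPatch W φ) {y₀ : E2} (hy₀ : y₀ ∈ W) {K : NNReal}
    (hK : 1 < K) : ∃ V ∈ 𝓝 y₀, ∀ y ∈ V, ∀ z ∈ V,
      dist (φ y) (φ z) ≤ K * dist (fderiv ℝ φ y₀ y) (fderiv ℝ φ y₀ z) ∧
      dist (fderiv ℝ φ y₀ y) (fderiv ℝ φ y₀ z) ≤ K * dist (φ y) (φ z) := by
  set L := fderiv ℝ φ y₀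
  obtain ⟨c, hc, hL⟩ := L.toLinearMap.exists_antilipschitzWith
    (LinearMap.ker_eq_bot.2 (h.injective y₀ hy₀))
  have hK' : (1 : ℝ) < K := hK
  have hc' : (0 : ℝ) < c := hc
  -- With this δ both 1 + δ ≤ K and 1 - δ = 1/K hold, so an error of relative size δ gives
  -- distortion at most K in both directions.
  set δ : ℝ := 1 - (K : ℝ)⁻¹
  have hKi : (K : ℝ)⁻¹ < 1 := inv_lt_one_of_one_lt₀ hK'
  have hδ : 0 < δ := by simp only [δ]; linarith
  have hδK : 1 + δ ≤ K := by
    have : 0 ≤ ((K : ℝ) - 1) ^ 2 / K := by positivity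
    have e : ((K : ℝ) - 1) ^ 2 / K = K - 1 - δ := by simp only [δ]; field_simp
    linarith
  have hpos : (0 : ℝ) < δ / c := div_pos hδ hc'
  obtain ⟨V, hV, hVL⟩ := (h.hasStrictFDerivAt hy₀).approximates_deriv_on_nhds
    (c := ⟨δ / c, hpos.le⟩) (Or.inr hpos)
  refine ⟨V, hV, fun y hy z hz => ?_⟩
  have h1 := hVL y hy z hz
  have h2 : ‖y - z‖ ≤ c * ‖L (y - z)‖ := by
    have := hL.le_mul_dist y z
    simp only [dist_eq_norm] at this
    simpa using this
  have h3 : ‖φ y - φ z - L (y - z)‖ ≤ δ * ‖L (y - z)‖ := by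
    refine h1.trans ?_
    calc δ / c * ‖y - z‖ ≤ δ / c * (c * ‖L (y - z)‖) := by gcongr
      _ = δ * ‖L (y - z)‖ := by field_simp
  simp only [dist_eq_norm, ← map_sub]
  constructor
  · calc ‖φ y - φ z‖ = ‖(φ y - φ z - L (y - z)) + L (y - z)‖ := by congr 1; abel
      _ ≤ δ * ‖L (y - z)‖ + ‖L (y - z)‖ := (norm_add_le _ _).trans (by gcongr)
      _ = (1 + δ) * ‖L (y - z)‖ := by ring
      _ ≤ K * ‖L (y - z)‖ := by gcongr
  · have h4 : ‖L (y - z)‖ ≤ ‖φ y - φ z‖ + δ * ‖L (y - z)‖ := by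
      calc ‖L (y - z)‖ = ‖(φ y - φ z) - (φ y - φ z - L (y - z))‖ := by congr 1; abel
        _ ≤ ‖φ y - φ z‖ + δ * ‖L (y - z)‖ := (norm_sub_le _ _).trans (by gcongr)
    have h5 : (K : ℝ)⁻¹ * ‖L (y - z)‖ ≤ ‖φ y - φ z‖ := by simp only [δ] at h4; linarith
    rwa [inv_mul_le_iff₀ (by linarith)] at h5

/-- The area formula, locally and up to a factor close to one. -/
theorem exists_nhds_area_le (h : IsImmersedPatch W φ) {y₀ : E2} (hy₀ : y₀ ∈ W) {K : NNReal}
    (hK : 1 < K) : ∃ V ∈ 𝓝 y₀, ∀ A ⊆ V, MeasurableSet A →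
      (Measure.euclideanHausdorffMeasure 2 : Measure E3) (φ '' A) ≤
        (K : ENNReal) ^ 3 * ∫⁻ y in A, ENNReal.ofReal (areaElement φ y) ∧
      ∫⁻ y in A, ENNReal.ofReal (areaElement φ y) ≤
        (K : ENNReal) ^ 3 * (Measure.euclideanHausdorffMeasure 2 : Measure E3) (φ '' A) := by
  obtain ⟨V, hV, hVd⟩ := h.eventually_dist_le hy₀ hK
  have hK' : (1 : ℝ) < K := hK
  have hJ := h.areaElement_pos hy₀
  have hcont := h.continuousOn_areaElement.continuousAt (h.isOpen.mem_nhds hy₀)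
  -- The oscillation of the area element costs one factor K; the distortion of distances costs K².
  -- This is the source of K³.
  have e1 : ∀ᶠ y in 𝓝 y₀, areaElement φ y < K * areaElement φ y₀ :=
    hcont.eventually (gt_mem_nhds (by nlinarith))
  have e2 : ∀ᶠ y in 𝓝 y₀, areaElement φ y₀ < K * areaElement φ y :=
    (hcont.const_mul (K : ℝ)).eventually (lt_mem_nhds (by nlinarith))
  refine ⟨V ∩ (W ∩ {y | areaElement φ y < K * areaElement φ y₀ ∧
    areaElement φ y₀ < K * areaElement φ y}),
    inter_mem hV (inter_mem (h.isOpen.mem_nhds hy₀) (e1.and e2)), fun A hA hAm => ?_⟩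
  set J₀ := ENNReal.ofReal (areaElement φ y₀)
  have hlin : (Measure.euclideanHausdorffMeasure 2 : Measure E3) (fderiv ℝ φ y₀ '' A) =
    J₀ * volume A := euclideanHausdorffMeasure_image_linear _ A
  have m1 := euclideanHausdorffMeasure_image_le (f := φ) (g := fderiv ℝ φ y₀) (A := A) (K := K)
    (h.injective y₀ hy₀).injOn fun y hy z hz => (hVd y (hA hy).1 z (hA hz).1).1
  have m2 := euclideanHausdorffMeasure_image_le (f := fderiv ℝ φ y₀) (g := φ) (A := A) (K := K)
    (h.injOn.mono fun y hy => (hA hy).2.1) fun y hy z hz => (hVd y (hA hy).1 z (hA hz).1).2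
  rw [hlin] at m1 m2
  have hofK : ∀ r : ℝ, ENNReal.ofReal (K * r) = K * ENNReal.ofReal r := fun r => by
    rw [ENNReal.ofReal_mul K.coe_nonneg, ENNReal.ofReal_coe_nnreal]
  constructor
  · refine m1.trans ?_
    rw [pow_succ (K : ENNReal) 2, mul_assoc]
    refine mul_le_mul' le_rfl ?_
    rw [← lintegral_const_mul' _ _ ENNReal.coe_ne_top, ← setLIntegral_const]
    refine setLIntegral_mono' hAm fun y hy => ?_
    rw [← hofK]
    exact ENNReal.ofReal_le_ofReal (hA hy).2.2.2.le
  · calc ∫⁻ y in A, ENNReal.ofReal (areaElement φ y) ≤ ∫⁻ y in A, K * J₀ := by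
          refine setLIntegral_mono' hAm fun y hy => ?_
          rw [← hofK]
          exact ENNReal.ofReal_le_ofReal (hA hy).2.2.1.le
      _ = K * (J₀ * volume A) := by rw [setLIntegral_const, mul_assoc]
      _ ≤ K * (K ^ 2 * (Measure.euclideanHausdorffMeasure 2 : Measure E3) (φ '' A)) := by gcongr
      _ = _ := by ring

theorem measurableSet_image (h : IsImmersedPatch W φ) {B : Set E2} (hBW : B ⊆ W)
    (hB : MeasurableSet B) : MeasurableSet (φ '' B) :=
  hB.image_of_continuousOn_injOn (h.contDiffOn.continuousOn.mono hBW) (h.injOn.mono hBW)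

/-- The local estimate becomes global with the same constant: countably many good neighbourhoods
cover W, they are made disjoint, and both sides are countably additive. For the image side this uses
injectivity of φ and measurability of injective continuous images. -/
theorem area_le (h : IsImmersedPatch W φ) {B : Set E2} (hBW : B ⊆ W) (hB : MeasurableSet B)
    {K : NNReal} (hK : 1 < K) :
    (Measure.euclideanHausdorffMeasure 2 : Measure E3) (φ '' B) ≤
      (K : ENNReal) ^ 3 * ∫⁻ y in B, ENNReal.ofReal (areaElement φ y) ∧
    ∫⁻ y in B, ENNReal.ofReal (areaElement φ y) ≤
      (K : ENNReal) ^ 3 * (Measure.euclideanHausdorffMeasure 2 : Measure E3) (φ '' B) := by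
  choose! V hV hVA using fun y (hy : y ∈ W) => h.exists_nhds_area_le hy hK
  obtain ⟨t, htW, htc, htV⟩ := TopologicalSpace.countable_cover_nhdsWithin
    (f := fun y => interior (V y)) (s := W)
    fun y hy => mem_nhdsWithin_of_mem_nhds (interior_mem_nhds.2 (hV y hy))
  rcases t.eq_empty_or_nonempty with rfl | hne
  · have : B = ∅ := by
      have : W ⊆ ∅ := by simpa using htV
      exact subset_empty_iff.1 (hBW.trans this)
    simp [this]
  obtain ⟨e, he⟩ := htc.exists_eq_range hne
  have heW : ∀ n, e n ∈ W := fun n => htW (he ▸ mem_range_self n)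
  set D : ℕ → Set E2 := disjointed fun n => interior (V (e n))
  have hDm : ∀ n, MeasurableSet (B ∩ D n) := fun n =>
    hB.inter (MeasurableSet.disjointed (fun n => isOpen_interior.measurableSet) n)
  have hDV : ∀ n, B ∩ D n ⊆ V (e n) := fun n =>
    inter_subset_right.trans ((disjointed_subset _ n).trans interior_subset)
  have hU : B = ⋃ n, B ∩ D n := by
    rw [← inter_iUnion, iUnion_disjointed]
    refine (inter_eq_left.2 fun y hy => ?_).symm
    have := htV (hBW hy)
    rw [he] at this
    simpa using this
  have hdis : Pairwise (Function.onFun Disjoint fun n => B ∩ D n) := fun m n hmn =>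
    (disjoint_disjointed _ hmn).mono inter_subset_right inter_subset_right
  have hdis' : Pairwise (Function.onFun Disjoint fun n => φ '' (B ∩ D n)) := fun m n hmn =>
    (disjoint_image_iff_of_injOn h.injOn (inter_subset_left.trans hBW)
      (inter_subset_left.trans hBW)).2 (hdis hmn)
  have hl : ∫⁻ y in B, ENNReal.ofReal (areaElement φ y) =
      ∑' n, ∫⁻ y in B ∩ D n, ENNReal.ofReal (areaElement φ y) := by
    conv_lhs => rw [hU]
    exact lintegral_iUnion hDm hdis _
  have hr : (Measure.euclideanHausdorffMeasure 2 : Measure E3) (φ '' B) =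
      ∑' n, (Measure.euclideanHausdorffMeasure 2 : Measure E3) (φ '' (B ∩ D n)) := by
    conv_lhs => rw [hU, image_iUnion]
    exact measure_iUnion hdis' fun n => h.measurableSet_image (inter_subset_left.trans hBW) (hDm n)
  rw [hl, hr, ← ENNReal.tsum_mul_left, ← ENNReal.tsum_mul_left]
  exact ⟨ENNReal.tsum_le_tsum fun n => (hVA _ (heW n) _ (hDV n) (hDm n)).1,
    ENNReal.tsum_le_tsum fun n => (hVA _ (heW n) _ (hDV n) (hDm n)).2⟩

/-- **Area formula** for patches. -/
theorem area_image (h : IsImmersedPatch W φ) {B : Set E2} (hBW : B ⊆ W) (hB : MeasurableSet B) :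
    (Measure.euclideanHausdorffMeasure 2 : Measure E3) (φ '' B) =
      ∫⁻ y in B, ENNReal.ofReal (areaElement φ y) := by
  -- Let K decrease to 1.
  have key : ∀ a b : ENNReal, (∀ K : NNReal, 1 < K → a ≤ (K : ENNReal) ^ 3 * b) → a ≤ b := by
    intro a b hab
    have ht : Tendsto (fun K : NNReal => (K : ENNReal) ^ 3 * b) (𝓝[>] 1) (𝓝 (1 * b)) := by
      refine ENNReal.Tendsto.mul_const ?_ (Or.inl one_ne_zero)
      have : Continuous fun K : NNReal => ((K ^ 3 : NNReal) : ENNReal) :=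
        ENNReal.continuous_coe.comp (continuous_pow 3)
      have := (this.tendsto 1).mono_left (nhdsWithin_le_nhds (s := Ioi 1))
      simpa using this
    rw [one_mul] at ht
    exact ge_of_tendsto ht (eventually_mem_nhdsWithin.mono fun K hK => hab K hK)
  exact le_antisymm (key _ _ fun K hK => (h.area_le hBW hB hK).1)
    (key _ _ fun K hK => (h.area_le hBW hB hK).2)

theorem measurableEmbedding (h : IsImmersedPatch W φ) {B : Set E2} (hBW : B ⊆ W)
    (hB : MeasurableSet B) : MeasurableEmbedding (B.domRestrict φ) :=
  (h.contDiffOn.continuousOn.mono hBW).measurableEmbedding hB (h.injOn.mono hBW)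

theorem aemeasurable_areaElement (h : IsImmersedPatch W φ) {B : Set E2} (hBW : B ⊆ W)
    (hB : MeasurableSet B) : AEMeasurable (areaElement φ) (volume.restrict B) :=
  (h.continuousOn_areaElement.mono hBW).aemeasurable hB

theorem map_withDensity_areaElement (h : IsImmersedPatch W φ) {B : Set E2} (hBW : B ⊆ W)
    (hB : MeasurableSet B) :
    Measure.map (B.domRestrict φ) (Measure.comap (↑)
      ((volume : Measure E2).withDensity fun y => ENNReal.ofReal (areaElement φ y))) =
      (Measure.euclideanHausdorffMeasure 2 : Measure E3).restrict (φ '' B) := by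
  ext s hs
  have hm := h.measurableEmbedding hBW hB
  rw [hm.map_apply, (MeasurableEmbedding.subtype_coe hB).comap_apply, Measure.restrict_apply hs]
  have e : ((↑) : B → E2) '' (B.domRestrict φ ⁻¹' s) = B ∩ φ ⁻¹' s := by
    ext y; simp [and_comm]
  have hBs : MeasurableSet (B ∩ φ ⁻¹' s) := by
    rw [← e]
    exact (MeasurableEmbedding.subtype_coe hB).measurableSet_image.2 (hm.measurable hs)
  rw [e, withDensity_apply _ hBs, ← h.area_image (inter_subset_left.trans hBW) hBs,
    image_inter_preimage, inter_comm]

/-- Change of variables for surface integrals over a patch. -/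
theorem integral_image {F : Type*} [NormedAddCommGroup F] [NormedSpace ℝ F]
    (h : IsImmersedPatch W φ) {B : Set E2} (hBW : B ⊆ W) (hB : MeasurableSet B) (f : E3 → F) :
    ∫ x in φ '' B, f x ∂(Measure.euclideanHausdorffMeasure 2 : Measure E3) =
      ∫ y in B, areaElement φ y • f (φ y) := by
  rw [← h.map_withDensity_areaElement hBW hB, (h.measurableEmbedding hBW hB).integral_map]
  simp only [Set.domRestrict_apply, ← Function.comp_apply (f := f), ENNReal.ofReal]
  rw [← (MeasurableEmbedding.subtype_coe hB).integral_map, map_comap_subtype_coe hB,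
    setIntegral_withDensity_eq_setIntegral_smul₀
      (h.aemeasurable_areaElement hBW hB).real_toNNReal _ hB]
  congr with y
  rw [NNReal.smul_def, Real.coe_toNNReal (areaElement φ y) (LinearMap.normDet_nonneg _)]

end IsImmersedPatch

/-! ### Surface calculus: normal, projection and divergences -/

theorem IsDefiningFunction.at_mem {Ω : Set E3} {x : E3} {U : Set E3} {ρ : E3 → ℝ}
    (h : IsDefiningFunction Ω x U ρ) {y : E3} (hy : y ∈ U) : IsDefiningFunction Ω y U ρ :=
  { h with mem := hy }

theorem IsDefiningFunction.gradient_ne_zero {Ω : Set E3} {x : E3} {U : Set E3} {ρ : E3 → ℝ}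
    (h : IsDefiningFunction Ω x U ρ) {y : E3} (hy : y ∈ U) : gradient ρ y ≠ 0 := by
  simpa [gradient] using h.fderiv_ne_zero y hy

theorem IsDefiningFunction.contDiffOn_gradient {Ω : Set E3} {x : E3} {U : Set E3} {ρ : E3 → ℝ}
    (h : IsDefiningFunction Ω x U ρ) : ContDiffOn ℝ ∞ (gradient ρ) U :=
  (InnerProductSpace.toDual ℝ E3).symm.contDiff.comp_contDiffOn
    (h.contDiffOn.fderiv_of_isOpen h.isOpen (by simp))

theorem proj_comp_smulRight_comp_proj (Ω : Set E3) (ℓ : E3 →L[ℝ] ℝ) (v x : E3) :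
    tr ((proj Ω x).comp ((ℓ.smulRight v).comp (proj Ω x))) = ℓ (proj Ω x (proj Ω x v)) := by
  have : (proj Ω x).comp ((ℓ.smulRight v).comp (proj Ω x)) =
      (ℓ.comp (proj Ω x)).smulRight (proj Ω x v) := by
    ext1 z; simp
  rw [this, tr_smulRight]; rfl

theorem proj_eq_self {Ω : Set E3} {x v : E3} (hv : ⟪v, normal Ω x⟫ = 0) : proj Ω x v = v := by
  rw [proj_apply, real_inner_comm, hv, zero_smul, sub_zero]

namespace IsSmoothDomain
variable {Ω : Set E3} {F : Type*} [NormedAddCommGroup F] [NormedSpace ℝ F]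

theorem norm_normal (hΩ : IsSmoothDomain Ω) {x : E3} (hx : x ∈ frontier Ω) :
    ‖normal Ω x‖ = 1 := by
  obtain ⟨U, ρ, h⟩ := hΩ.exists_definingFunction x hx
  rw [normal_eq hΩ.isOpen hx h, norm_smul, norm_inv, norm_norm,
    inv_mul_cancel₀ (norm_ne_zero_iff.2 (h.gradient_ne_zero h.mem))]

theorem inner_normal_self (hΩ : IsSmoothDomain Ω) {x : E3} (hx : x ∈ frontier Ω) :
    ⟪normal Ω x, normal Ω x⟫ = 1 := by
  rw [real_inner_self_eq_norm_sq, hΩ.norm_normal hx]; norm_num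

theorem contDiffOn_normal (hΩ : IsSmoothDomain Ω) :
    ContDiffOn ℝ ∞ (normal Ω) (frontier Ω) := by
  intro x hx
  obtain ⟨U, ρ, h⟩ := hΩ.exists_definingFunction x hx
  have hU : U ∈ 𝓝 x := h.isOpen.mem_nhds h.mem
  have hg : ContDiffAt ℝ ∞ (gradient ρ) x := h.contDiffOn_gradient.contDiffAt hU
  have hn : ContDiffAt ℝ ∞ (fun y => ‖gradient ρ y‖⁻¹ • gradient ρ y) x :=
    ((hg.norm ℝ (h.gradient_ne_zero h.mem)).inv
      (norm_ne_zero_iff.2 (h.gradient_ne_zero h.mem))).smul hg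
  refine hn.contDiffWithinAt.congr_of_eventuallyEq ?_ (normal_eq hΩ.isOpen hx h)
  filter_upwards [mem_nhdsWithin_of_mem_nhds hU, self_mem_nhdsWithin] with y hyU hy
  exact normal_eq hΩ.isOpen hy (h.at_mem hyU)

theorem continuousOn_proj (hΩ : IsSmoothDomain Ω) : ContinuousOn (proj Ω) (frontier Ω) := by
  have h : ContDiffOn ℝ ∞ (fun x => innerSL ℝ (normal Ω x)) (frontier Ω) :=
    (innerSL ℝ (E := E3)).contDiff.comp_contDiffOn hΩ.contDiffOn_normal
  exact continuousOn_const.sub (h.smulRight hΩ.contDiffOn_normal).continuousOn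

/-- Derivatives of maps into the surface are tangential. -/
theorem inner_normal_of_hasFDerivAt (hΩ : IsSmoothDomain Ω) {φ : F → E3} {L : F →L[ℝ] E3} {y : F}
    (hφ : HasFDerivAt φ L y) (hm : ∀ᶠ z in 𝓝 y, φ z ∈ frontier Ω) (e : F) :
    ⟪L e, normal Ω (φ y)⟫ = 0 := by
  have hx : φ y ∈ frontier Ω := hm.self_of_nhds
  obtain ⟨U, ρ, h⟩ := hΩ.exists_definingFunction (φ y) hx
  have hU : U ∈ 𝓝 (φ y) := h.isOpen.mem_nhds h.mem
  have h1 := (h.differentiableAt h.mem).hasFDerivAt.comp y hφ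
  have h2 : (ρ ∘ φ) =ᶠ[𝓝 y] fun _ => 0 := by
    filter_upwards [hm, hφ.continuousAt.eventually hU] with z hz hzU
    exact (h.mem_frontier_iff hΩ.isOpen hzU).1 hz
  have h3 := (h1.congr_of_eventuallyEq h2.symm).unique (hasFDerivAt_const (0 : ℝ) y)
  have h4 : fderiv ℝ ρ (φ y) (L e) = 0 := congrArg (fun A : F →L[ℝ] ℝ => A e) h3
  have h5 : ⟪gradient ρ (φ y), L e⟫ = 0 := by simpa [gradient] using h4
  rw [normal_eq hΩ.isOpen hx h, real_inner_smul_right, real_inner_comm, h5, mul_zero]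

/-- The derivative chosen by `fderivWithin` need not vary continuously, since its normal part is
arbitrary. Near each point the C¹ hypothesis supplies a family f' of derivatives, continuous at that
point, and f' P is the same map as `gradC` there. -/
theorem continuousOn_gradC (hΩ : IsSmoothDomain Ω) {f : E3 → F}
    (hf : ContDiffOn ℝ 1 f (frontier Ω)) : ContinuousOn (gradC Ω f) (frontier Ω) := by
  intro x hx
  obtain ⟨u, hu, -, -, f', hf', hc⟩ :=
    (contDiffWithinAt_succ_iff_hasFDerivWithinAt' (n := 0) (by simp)).1 (hf x hx)
  rw [insert_eq_of_mem hx] at hu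
  have h1 : ContinuousWithinAt (fun y => (f' y).comp (proj Ω y)) (frontier Ω) x :=
    hc.continuousWithinAt.clm_comp (hΩ.continuousOn_proj x hx)
  have h2 : ∀ y ∈ frontier Ω, y ∈ u → gradC Ω f y = (f' y).comp (proj Ω y) := fun y hy hyu =>
    gradC_eq hΩ hy (hf' y hyu)
  refine h1.congr_of_eventuallyEq ?_ (h2 x hx (mem_of_mem_nhdsWithin hx hu))
  filter_upwards [hu, self_mem_nhdsWithin] with y hyu hy
  exact h2 y hy hyu

theorem continuousOn_divP (hΩ : IsSmoothDomain Ω) {w : E3 → E3}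
    (hw : ContDiffOn ℝ 1 w (frontier Ω)) : ContinuousOn (divP Ω w) (frontier Ω) :=
  continuous_tr.comp_continuousOn (hΩ.continuousOn_proj.clm_comp (hΩ.continuousOn_gradC hw))

theorem continuousOn_meanCurvature (hΩ : IsSmoothDomain Ω) :
    ContinuousOn (meanCurvature Ω) (frontier Ω) :=
  continuous_tr.comp_continuousOn
    (hΩ.continuousOn_gradC (hΩ.contDiffOn_normal.of_le (by simp))).neg

theorem divP_eq (hΩ : IsSmoothDomain Ω) {w : E3 → E3} {x : E3} (hx : x ∈ frontier Ω)
    {A : E3 →L[ℝ] E3} (hA : HasFDerivWithinAt w A (frontier Ω) x) :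
    divP Ω w x = tr ((proj Ω x).comp (A.comp (proj Ω x))) := by
  rw [divP, gradP, gradC_eq hΩ hx hA]

theorem proj_normal (hΩ : IsSmoothDomain Ω) {x : E3} (hx : x ∈ frontier Ω) :
    proj Ω x (normal Ω x) = 0 := by
  rw [proj_apply, hΩ.inner_normal_self hx, one_smul, sub_self]

/-- `div_P u = div_S (P u) - (u · ν) H`. -/
theorem divP_eq_divS_sub (hΩ : IsSmoothDomain Ω) {u : E3 → E3} {x : E3} (hx : x ∈ frontier Ω)
    (hu : DifferentiableWithinAt ℝ u (frontier Ω) x) :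
    divP Ω u x = divS Ω (tangentialPart Ω u) x - ⟪u x, normal Ω x⟫ * meanCurvature Ω x := by
  have hν : HasFDerivWithinAt (normal Ω) (fderivWithin ℝ (normal Ω) (frontier Ω) x)
      (frontier Ω) x := (hΩ.contDiffOn_normal.differentiableOn (by simp) x hx).hasFDerivWithinAt
  obtain ⟨ℓ, hℓ⟩ : DifferentiableWithinAt ℝ (fun y => ⟪normal Ω y, u y⟫) (frontier Ω) x :=
    hν.differentiableWithinAt.inner ℝ hu
  have hu' : HasFDerivWithinAt (tangentialPart Ω u) _ (frontier Ω) x :=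
    hu.hasFDerivWithinAt.sub (hℓ.smul hν)
  -- `divS` and `divP` have the same body, so `divP_eq` serves for both.
  change _ = divP Ω _ x - _
  rw [hΩ.divP_eq hx hu.hasFDerivWithinAt, hΩ.divP_eq hx hu']
  rw [meanCurvature, shapeOperator, tr_neg, gradC,
    ← tr_proj_comp_comp_proj (hΩ.norm_normal hx)]
  have e : ∀ A B C : E3 →L[ℝ] E3, tr ((proj Ω x).comp ((A - (B + C)).comp (proj Ω x))) =
      tr ((proj Ω x).comp (A.comp (proj Ω x))) - tr ((proj Ω x).comp (B.comp (proj Ω x)))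
       - tr ((proj Ω x).comp (C.comp (proj Ω x))) := fun A B C => by
    simp [tr_eq_sum, Finset.sum_sub_distrib, Finset.sum_add_distrib]; ring
  have e2 : ∀ (c : ℝ) (A : E3 →L[ℝ] E3), tr ((proj Ω x).comp ((c • A).comp (proj Ω x))) =
      c * tr ((proj Ω x).comp (A.comp (proj Ω x))) := fun c A => by
    simp [tr_eq_sum, Finset.mul_sum]
  -- In the derivative of ⟨ν,u⟩ν the summand that differentiates the coefficient has values along ν
  -- and is killed by P. The other summand is ⟨ν,u⟩ ∇ν, whose projected trace is -(u·ν) H.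
  rw [e, e2, proj_comp_smulRight_comp_proj, hΩ.proj_normal hx, real_inner_comm]
  simp

/-- Product rule for the surface divergence of a multiple of a tangential field. -/
theorem divS_smul (hΩ : IsSmoothDomain Ω) {v : E3 → ℝ} {w : E3 → E3} {x : E3}
    (hx : x ∈ frontier Ω) (hv : DifferentiableWithinAt ℝ v (frontier Ω) x)
    (hw : DifferentiableWithinAt ℝ w (frontier Ω) x) (ht : ⟪w x, normal Ω x⟫ = 0) :
    divS Ω (fun y => v y • w y) x = v x * divS Ω w x + gradC Ω v x (w x) := by
  change divP Ω _ x = _ * divP Ω _ x + _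
  rw [hΩ.divP_eq hx (hv.hasFDerivWithinAt.fun_smul hw.hasFDerivWithinAt),
    hΩ.divP_eq hx hw.hasFDerivWithinAt]
  have e : ∀ (c : ℝ) (A B : E3 →L[ℝ] E3),
      tr ((proj Ω x).comp ((c • A + B).comp (proj Ω x))) =
      c * tr ((proj Ω x).comp (A.comp (proj Ω x))) + tr ((proj Ω x).comp (B.comp (proj Ω x))) :=
    fun c A B => by
      simp [tr_eq_sum, Finset.mul_sum, Finset.sum_add_distrib]
  rw [e, proj_comp_smulRight_comp_proj, proj_eq_self ht, gradC, ContinuousLinearMap.comp_apply]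

theorem isTangential_tangentialPart (hΩ : IsSmoothDomain Ω) (u : E3 → E3) :
    IsTangential Ω (tangentialPart Ω u) := by
  intro x hx
  rw [tangentialPart, proj_apply, inner_sub_left, real_inner_smul_left, hΩ.inner_normal_self hx,
    real_inner_comm]
  ring

theorem contDiffOn_tangentialPart (hΩ : IsSmoothDomain Ω) {u : E3 → E3}
    (hu : ContDiffOn ℝ 1 u (frontier Ω)) : ContDiffOn ℝ 1 (tangentialPart Ω u) (frontier Ω) := by
  have hν : ContDiffOn ℝ 1 (normal Ω) (frontier Ω) := hΩ.contDiffOn_normal.of_le (by simp)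
  exact hu.sub ((hν.inner ℝ hu).smul hν)

end IsSmoothDomain

theorem divS_congr {Ω : Set E3} {w w' : E3 → E3} (h : EqOn w w' (frontier Ω)) {x : E3}
    (hx : x ∈ frontier Ω) : divS Ω w x = divS Ω w' x := by
  rw [divS, divS, covDeriv, covDeriv, fderivWithin_congr h (h hx)]

/-- Additivity goes through `divP_eq`: derivatives along the surface are not unique, so the chosen
derivative of a sum need not be the sum of the chosen ones. -/
theorem IsSmoothDomain.divS_sum {Ω : Set E3} (hΩ : IsSmoothDomain Ω) {ι : Type*} (s : Finset ι)
    {w : ι → E3 → E3} {x : E3} (hx : x ∈ frontier Ω)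
    (hw : ∀ i ∈ s, DifferentiableWithinAt ℝ (w i) (frontier Ω) x) :
    divS Ω (fun y => ∑ i ∈ s, w i y) x = ∑ i ∈ s, divS Ω (w i) x := by
  have h1 := HasFDerivWithinAt.fun_sum fun i hi => (hw i hi).hasFDerivWithinAt
  refine (hΩ.divP_eq hx h1).trans ?_
  simp only [divS, covDeriv, tr_eq_sum, ContinuousLinearMap.comp_apply,
    sum_apply, map_sum]
  rw [Finset.sum_comm]
  refine Finset.sum_congr rfl fun j _ => ?_
  simp

/-! ### Local charts and finiteness of area -/

/-- A twice continuously differentiable parametrization `φ : W → frontier Ω ∩ O` with continuous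
inverse `θ`. -/
structure IsSurfaceChart (Ω : Set E3) (O : Set E3) (W : Set E2) (φ : E2 → E3) (θ : E3 → E2) :
    Prop where
  isOpen_target : IsOpen O
  patch : IsImmersedPatch W φ
  contDiffOn : ContDiffOn ℝ 2 φ W
  mapsTo : ∀ y ∈ W, φ y ∈ frontier Ω ∩ O
  leftInv : ∀ y ∈ W, θ (φ y) = y
  inv_mapsTo : ∀ x ∈ frontier Ω ∩ O, θ x ∈ W
  rightInv : ∀ x ∈ frontier Ω ∩ O, φ (θ x) = x
  continuousOn_inv : ContinuousOn θ O

/-- Linear coordinates on the tangent plane: j parametrizes ker ℓ, and g reads the coordinates off.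
-/
theorem exists_injective_range_eq_ker {ℓ : E3 →L[ℝ] ℝ} (hℓ : ℓ ≠ 0) :
    ∃ (j : E2 →L[ℝ] E3) (g : E3 →L[ℝ] E2), (∀ y, g (j y) = y) ∧ (∀ y, ℓ (j y) = 0) ∧
      ∀ z, ℓ z = 0 → j (g z) = z := by
  have hr : Module.finrank ℝ (LinearMap.ker (ℓ : E3 →ₗ[ℝ] ℝ)) = 2 := by
    have h := LinearMap.finrank_range_add_finrank_ker (ℓ : E3 →ₗ[ℝ] ℝ)
    have h2 : LinearMap.range (ℓ : E3 →ₗ[ℝ] ℝ) = ⊤ := by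
      rw [LinearMap.range_eq_top]
      exact LinearMap.surjective fun h0 => hℓ (ContinuousLinearMap.coe_injective h0)
    rw [h2, finrank_top] at h
    simp at h
    omega
  let e : E2 ≃L[ℝ] LinearMap.ker (ℓ : E3 →ₗ[ℝ] ℝ) :=
    ContinuousLinearEquiv.ofFinrankEq (by rw [hr]; simp)
  let j : E2 →L[ℝ] E3 := (LinearMap.ker (ℓ : E3 →ₗ[ℝ] ℝ)).subtypeL.comp (e : E2 →L[ℝ] _)
  have hj : Function.Injective j := Subtype.val_injective.comp e.injective
  obtain ⟨g, hg⟩ := LinearMap.exists_leftInverse_of_injective (j : E2 →ₗ[ℝ] E3)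
    (LinearMap.ker_eq_bot.2 hj)
  have hgj : ∀ y, g (j y) = y := fun y => congrArg (fun A : E2 →ₗ[ℝ] E2 => A y) hg
  refine ⟨j, LinearMap.toContinuousLinearMap g, hgj, fun y => (e y).2, fun z hz => ?_⟩
  obtain ⟨y, hy⟩ := e.surjective ⟨z, hz⟩
  have : j y = z := congrArg Subtype.val hy
  rw [← this]
  exact congrArg j (hgj y)

theorem IsSmoothDomain.exists_surfaceChart {Ω : Set E3} (hΩ : IsSmoothDomain Ω) {x : E3}
    (hx : x ∈ frontier Ω) : ∃ O W φ θ, x ∈ O ∧ IsSurfaceChart Ω O W φ θ := by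
  obtain ⟨U, ρ, h⟩ := hΩ.exists_definingFunction x hx
  have hU : U ∈ 𝓝 x := h.isOpen.mem_nhds h.mem
  set ℓ := fderiv ℝ ρ x
  have hℓ : ℓ ≠ 0 := h.fderiv_ne_zero x h.mem
  obtain ⟨j, g, hgj, hℓj, hjg⟩ := exists_injective_range_eq_ker hℓ
  obtain ⟨n, hn⟩ : ∃ n, ℓ n = 1 := by
    have : Function.Surjective ℓ := LinearMap.surjective (f := (ℓ : E3 →ₗ[ℝ] ℝ)) fun h0 =>
      hℓ (ContinuousLinearMap.coe_injective h0)
    exact this 1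
  -- Φ straightens the surface: ℓ ∘ Φ = ρ because ℓ n = 1, so the zero set of ρ goes to the plane
  -- ker ℓ, and DΦ is the identity at x. The chart is the local inverse of Φ restricted to that
  -- plane.
  let Φ : E3 → E3 := fun z => z + (ρ z - ℓ z) • n
  have h2 : (2 : WithTop ℕ∞) ≤ ∞ := ENat.LEInfty.out
  have hΦU : ContDiffOn ℝ 2 Φ U :=
    contDiffOn_id.add (((h.contDiffOn.of_le h2).sub ℓ.contDiff.contDiffOn).smul
      contDiffOn_const)
  have hΦ : ContDiffAt ℝ 2 Φ x := hΦU.contDiffAt hU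
  have hΦ' : HasFDerivAt Φ ((ContinuousLinearEquiv.refl ℝ E3 : E3 ≃L[ℝ] E3) : E3 →L[ℝ] E3) x := by
    have := (hasFDerivAt_id x).add
      (((h.differentiableAt h.mem).hasFDerivAt.sub ℓ.hasFDerivAt).smul_const n)
    convert! this using 1
    ext1 z
    simp [ℓ]
  have hℓΦ : ∀ z, ℓ (Φ z) = ρ z := fun z => by simp [Φ, hn]
  set e := hΦ.toOpenPartialHomeomorph Φ hΦ' (by simp)
  have hxe : x ∈ e.source := hΦ.mem_toOpenPartialHomeomorph_source hΦ' (by simp)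
  have heΦ : ∀ z, e z = Φ z := fun z => rfl
  have hsymm : ContDiffAt ℝ 2 e.symm (Φ x) := hΦ.to_localInverse hΦ' (by simp)
  have hex : e.symm (Φ x) = x := e.left_inv hxe
  have hev : ∀ᶠ z in 𝓝 (Φ x), ContDiffAt ℝ 2 e.symm z ∧ e.symm z ∈ U ∧ z ∈ e.target := by
    refine (hsymm.eventually (by simp)).and
      ((hsymm.continuousAt.eventually (by rw [hex]; exact hU)).and ?_)
    exact e.open_target.mem_nhds (e.map_source hxe)
  obtain ⟨T, hT, hTo, hxT⟩ := mem_nhds_iff.1 hev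
  have hS : ∀ z ∈ e.source ∩ Φ ⁻¹' T, z ∈ U := fun z hz => by
    have := (hT hz.2).2.1
    rwa [show e.symm (Φ z) = z from e.left_inv hz.1] at this
  have hρ : ∀ z ∈ frontier Ω ∩ (e.source ∩ Φ ⁻¹' T), j (g (Φ z)) = Φ z := fun z hz =>
    hjg _ (by rw [hℓΦ]; exact (h.mem_frontier_iff hΩ.isOpen (hS z hz.2)).1 hz.1)
  have hright : ∀ y ∈ j ⁻¹' T, Φ (e.symm (j y)) = j y := fun y hy => e.right_inv (hT hy).2.2
  have hmaps : ∀ y ∈ j ⁻¹' T, e.symm (j y) ∈ frontier Ω ∩ (e.source ∩ Φ ⁻¹' T) := by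
    intro y hy
    refine ⟨?_, e.map_target (hT hy).2.2, ?_⟩
    · rw [h.mem_frontier_iff hΩ.isOpen (hT hy).2.1, ← hℓΦ, hright y hy, hℓj]
    · rw [mem_preimage, hright y hy]; exact hy
  have hleft : ∀ y ∈ j ⁻¹' T, g (Φ (e.symm (j y))) = y := fun y hy => by rw [hright y hy, hgj]
  have hWo : IsOpen (j ⁻¹' T) := hTo.preimage j.continuous
  have hφ : ContDiffOn ℝ 2 (fun y => e.symm (j y)) (j ⁻¹' T) := fun y hy =>
    ((hT hy).1.comp y j.contDiff.contDiffAt).contDiffWithinAt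
  refine ⟨e.source ∩ Φ ⁻¹' T, j ⁻¹' T, fun y => e.symm (j y), fun z => g (Φ z), ⟨hxe, hxT⟩,
    e.isOpen_inter_preimage hTo, ⟨hWo, hφ.of_le (by norm_num), ?_, ?_⟩, hφ, hmaps, hleft, ?_, ?_, ?_⟩
  · intro y hy z hz hyz
    rw [← hleft y hy, ← hleft z hz]
    exact congrArg (fun a => g (Φ a)) hyz
  · intro y hy
    have d1 : HasFDerivAt (fun y => e.symm (j y)) _ y :=
      ((hφ.contDiffAt (hWo.mem_nhds hy)).differentiableAt (by simp)).hasFDerivAt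
    have d2 : HasFDerivAt Φ _ (e.symm (j y)) :=
      ((hΦU.contDiffAt (h.isOpen.mem_nhds (hT hy).2.1)).differentiableAt (by simp)).hasFDerivAt
    have d3 := g.hasFDerivAt.comp y (d2.comp y d1)
    -- Differentiating θ ∘ φ = id gives a left inverse of Dφ, so φ is an immersion.
    have d4 : HasFDerivAt (g ∘ Φ ∘ fun y => e.symm (j y)) (ContinuousLinearMap.id ℝ E2) y := by
      refine (hasFDerivAt_id y).congr_of_eventuallyEq ?_
      filter_upwards [hWo.mem_nhds hy] with z hz
      exact hleft z hz
    have d5 := d3.unique d4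
    refine Function.LeftInverse.injective (g := fun a => g (fderiv ℝ Φ (e.symm (j y)) a))
      fun a => ?_
    exact congrArg (fun A : E2 →L[ℝ] E2 => A a) d5
  · intro z hz
    rw [mem_preimage, hρ z hz]; exact hz.2.2
  · intro z hz
    rw [hρ z hz]
    exact e.left_inv hz.2.1
  · exact g.continuous.comp_continuousOn (hΦU.continuousOn.mono hS)

namespace IsSurfaceChart
variable {Ω O : Set E3} {W : Set E2} {φ : E2 → E3} {θ : E3 → E2}

theorem image_eq (h : IsSurfaceChart Ω O W φ θ) : φ '' W = frontier Ω ∩ O := by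
  ext x
  constructor
  · rintro ⟨y, hy, rfl⟩; exact h.mapsTo y hy
  · exact fun hx => ⟨θ x, h.inv_mapsTo x hx, h.rightInv x hx⟩

/-- The coordinates of a compact piece of the surface inside the chart form a compact set. -/
theorem isCompact_preimage (h : IsSurfaceChart Ω O W φ θ) {C : Set E3} (hC : IsCompact C)
    (hCO : C ⊆ O) (hCS : C ⊆ frontier Ω) : IsCompact (θ '' C) ∧ θ '' C ⊆ W :=
  ⟨hC.image_of_continuousOn (h.continuousOn_inv.mono hCO),
    image_subset_iff.2 fun x hx => h.inv_mapsTo x ⟨hCS hx, hCO hx⟩⟩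

theorem inner_normal_fderiv (h : IsSurfaceChart Ω O W φ θ) (hΩ : IsSmoothDomain Ω) {y : E2}
    (hy : y ∈ W) (e : E2) : ⟪fderiv ℝ φ y e, normal Ω (φ y)⟫ = 0 :=
  hΩ.inner_normal_of_hasFDerivAt (h.patch.hasStrictFDerivAt hy).hasFDerivAt
    (Filter.eventually_of_mem (h.patch.isOpen.mem_nhds hy) fun z hz => (h.mapsTo z hz).1) e

end IsSurfaceChart

theorem IsImmersedPatch.area_image_lt_top {W : Set E2} {φ : E2 → E3} (h : IsImmersedPatch W φ)
    {C : Set E2} (hC : IsCompact C) (hCW : C ⊆ W) :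
    (Measure.euclideanHausdorffMeasure 2 : Measure E3) (φ '' C) < ⊤ := by
  rw [h.area_image hCW hC.measurableSet]
  exact ((h.continuousOn_areaElement.mono hCW).integrableOn_compact hC).lintegral_lt_top

/-- Compactness reduces this to finite area near each point, and there the surface is covered by the
image of a compact set of coordinates. -/
theorem IsSmoothDomain.isFiniteMeasure {Ω : Set E3} (hΩ : IsSmoothDomain Ω) :
    IsFiniteMeasure (surfaceMeasure Ω) := by
  refine ⟨?_⟩
  rw [surfaceMeasure, Measure.restrict_apply_univ]
  refine hΩ.isCompact_frontier.measure_lt_top_of_nhdsWithin fun x hx => ?_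
  obtain ⟨O, W, φ, θ, hxO, h⟩ := hΩ.exists_surfaceChart hx
  obtain ⟨C, hC, hCW, hCc⟩ := local_compact_nhds
    (h.patch.isOpen.mem_nhds (h.inv_mapsTo x ⟨hx, hxO⟩))
  refine ⟨φ '' C, ?_, h.patch.area_image_lt_top hCc hCW⟩
  have h1 : θ ⁻¹' C ∈ 𝓝 x := (h.continuousOn_inv.continuousAt (h.isOpen_target.mem_nhds hxO)) hC
  filter_upwards [self_mem_nhdsWithin, mem_nhdsWithin_of_mem_nhds h1,
    mem_nhdsWithin_of_mem_nhds (h.isOpen_target.mem_nhds hxO)] with z hz hzC hzO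
  exact ⟨θ z, hzC, h.rightInv z ⟨hz, hzO⟩⟩

namespace IsSmoothDomain
variable {Ω : Set E3} {F : Type*} [NormedAddCommGroup F]

theorem memLp_of_continuousOn (hΩ : IsSmoothDomain Ω) {f : E3 → F}
    (hf : ContinuousOn f (frontier Ω)) (p : ENNReal) : MemLp f p (surfaceMeasure Ω) := by
  have := hΩ.isFiniteMeasure
  obtain ⟨C, hC⟩ := hΩ.isCompact_frontier.exists_bound_of_continuousOn hf
  refine MemLp.of_bound ?_ C ?_
  · exact hf.aestronglyMeasurable_of_isCompact hΩ.isCompact_frontier isClosed_frontier.measurableSet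
  · exact (ae_restrict_iff' isClosed_frontier.measurableSet).2 (Eventually.of_forall hC)

theorem integrable_of_continuousOn (hΩ : IsSmoothDomain Ω) {f : E3 → F}
    (hf : ContinuousOn f (frontier Ω)) : Integrable f (surfaceMeasure Ω) :=
  memLp_one_iff_integrable.1 (hΩ.memLp_of_continuousOn hf 1)

end IsSmoothDomain

theorem integral_surface_congr {Ω : Set E3} {F : Type*} [NormedAddCommGroup F] [NormedSpace ℝ F]
    {f g : E3 → F} (h : EqOn f g (frontier Ω)) :
    ∫ x, f x ∂surfaceMeasure Ω = ∫ x, g x ∂surfaceMeasure Ω :=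
  setIntegral_congr_fun isClosed_frontier.measurableSet h

/-! ### The divergence theorem -/

/-- A compactly supported derivative in a fixed direction integrates to zero. -/
theorem setIntegral_fderiv_eq_zero {F : E2 → ℝ} {W K : Set E2} (hW : IsOpen W) (hK : IsCompact K)
    (hKW : K ⊆ W) (hF : ContDiffOn ℝ 1 F W) (h0 : ∀ y ∈ W, y ∉ K → F y = 0) (e : E2) :
    IntegrableOn (fun y => fderiv ℝ F y e) W ∧ ∫ y in W, fderiv ℝ F y e = 0 := by
  classical
  -- Extension by zero is C¹ on the whole plane, as F vanishes on W outside the compact set K ⊆ W.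
  -- Integration by parts against the constant 1 then applies.
  set G : E2 → ℝ := W.indicator F
  have hGW : ∀ y ∈ W, G =ᶠ[𝓝 y] F := fun y hy => by
    filter_upwards [hW.mem_nhds hy] with z hz using indicator_of_mem hz F
  have hGK : ∀ y ∉ K, G y = 0 := fun y hy => by
    by_cases hyW : y ∈ W
    · rw [← h0 y hyW hy]; exact indicator_of_mem hyW F
    · exact indicator_of_notMem hyW F
  have hG : ContDiff ℝ 1 G := by
    rw [contDiff_iff_contDiffAt]
    intro y
    by_cases hy : y ∈ W
    · exact (hF.contDiffAt (hW.mem_nhds hy)).congr_of_eventuallyEq (hGW y hy)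
    · refine (contDiffAt_const (c := (0 : ℝ))).congr_of_eventuallyEq ?_
      filter_upwards [hK.isClosed.isOpen_compl.mem_nhds fun h => hy (hKW h)] with z hz
      exact hGK z hz
  have hGc : HasCompactSupport G := HasCompactSupport.intro hK fun y hy => hGK y hy
  have hGc' : HasCompactSupport fun y => fderiv ℝ G y e := hGc.fderiv_apply (𝕜 := ℝ) e
  have hint' : Integrable fun y => fderiv ℝ G y e :=
    ((hG.continuous_fderiv (by simp)).clm_apply continuous_const).integrable_of_hasCompactSupport
      hGc'
  have hint : Integrable G := hG.continuous.integrable_of_hasCompactSupport hGc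
  have h1 : ∫ y, fderiv ℝ G y e = 0 := by
    have := integral_mul_fderiv_eq_neg_fderiv_mul_of_integrable (μ := (volume : Measure E2))
      (f := fun _ => (1 : ℝ)) (g := G) (v := e) (by simp) (by simpa using hint')
      (by simpa using hint) (fun x _ => differentiableAt_const _)
      (fun x _ => hG.differentiable (by simp) x)
    simpa using this
  have h2 : EqOn (fun y => fderiv ℝ F y e) (fun y => fderiv ℝ G y e) W := fun y hy => by
    simp only [(hGW y hy).fderiv_eq]
  refine ⟨(integrableOn_congr_fun h2 hW.measurableSet).2 hint'.integrableOn, ?_⟩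
  rw [setIntegral_congr_fun hW.measurableSet h2, ← h1]
  refine setIntegral_eq_integral_of_forall_compl_eq_zero fun y hy => ?_
  have : G =ᶠ[𝓝 y] fun _ => 0 := by
    filter_upwards [hK.isClosed.isOpen_compl.mem_nhds fun h => hy (hKW h)] with z hz
    exact hGK z hz
  rw [this.fderiv_eq]; simp

theorem fderiv_inner_crossL {a b c : E2 → E3} {a' b' c' : E2 →L[ℝ] E3} {y : E2}
    (ha : HasFDerivAt a a' y) (hb : HasFDerivAt b b' y) (hc : HasFDerivAt c c' y) (e : E2) :
    fderiv ℝ (fun z => ⟪a z, crossL (b z) (c z)⟫) y e =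
      ⟪a' e, crossL (b y) (c y)⟫ + ⟪a y, crossL (b' e) (c y)⟫ + ⟪a y, crossL (b y) (c' e)⟫ := by
  rw [(ha.inner ℝ (crossL.hasFDerivAt_of_bilinear hb hc)).fderiv]
  simp [fderivInnerCLM_apply, inner_add_right]
  ring

theorem contDiffOn_inner_crossL {a b c : E2 → E3} {W : Set E2} (ha : ContDiffOn ℝ 1 a W)
    (hb : ContDiffOn ℝ 1 b W) (hc : ContDiffOn ℝ 1 c W) :
    ContDiffOn ℝ 1 (fun z => ⟪a z, crossL (b z) (c z)⟫) W :=
  ha.inner ℝ ((crossL.contDiff.comp_contDiffOn hb).clm_apply hc)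

/-- The unit normal of a chart, oriented by the chart. -/
def chartNormal (φ : E2 → E3) (y : E2) : E3 :=
  (areaElement φ y)⁻¹ • crossL (fderiv ℝ φ y (EuclideanSpace.single 0 1))
      (fderiv ℝ φ y (EuclideanSpace.single 1 1))

namespace IsSurfaceChart
variable {Ω O : Set E3} {W : Set E2} {φ : E2 → E3} {θ : E3 → E2}

theorem contDiffOn_fderiv_apply (h : IsSurfaceChart Ω O W φ θ) (e : E2) :
    ContDiffOn ℝ 1 (fun y => fderiv ℝ φ y e) W :=
  (h.contDiffOn.fderiv_of_isOpen h.patch.isOpen (by norm_num)).clm_apply contDiffOn_const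

theorem crossL_ne_zero (h : IsSurfaceChart Ω O W φ θ) {y : E2} (hy : y ∈ W) :
    crossL (fderiv ℝ φ y (EuclideanSpace.single 0 1))
      (fderiv ℝ φ y (EuclideanSpace.single 1 1)) ≠ 0 := by
  rw [← norm_ne_zero_iff, ← areaElement_eq]
  exact (h.patch.areaElement_pos hy).ne'

theorem contDiffOn_chartNormal (h : IsSurfaceChart Ω O W φ θ) :
    ContDiffOn ℝ 1 (chartNormal φ) W := by
  have hn : ContDiffOn ℝ 1 (fun y => crossL (fderiv ℝ φ y (EuclideanSpace.single 0 1))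
      (fderiv ℝ φ y (EuclideanSpace.single 1 1))) W :=
    (crossL.contDiff.comp_contDiffOn (h.contDiffOn_fderiv_apply _)).clm_apply
      (h.contDiffOn_fderiv_apply _)
  unfold chartNormal
  simp only [areaElement_eq]
  exact ((hn.norm ℝ fun y hy => h.crossL_ne_zero hy).inv
    fun y hy => norm_ne_zero_iff.2 (h.crossL_ne_zero hy)).smul hn

theorem inner_chartNormal_self (h : IsSurfaceChart Ω O W φ θ) {y : E2} (hy : y ∈ W) :
    ⟪chartNormal φ y, chartNormal φ y⟫ = 1 := by
  have := h.crossL_ne_zero hy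
  rw [real_inner_self_eq_norm_sq, chartNormal, areaElement_eq, norm_smul, norm_inv, norm_norm,
    inv_mul_cancel₀ (norm_ne_zero_iff.2 this)]
  norm_num

/-- The chart normal is a multiple of ν, possibly of the opposite sign. Working with it avoids
orienting the charts. -/
theorem inner_chartNormal (h : IsSurfaceChart Ω O W φ θ) (hΩ : IsSmoothDomain Ω) {y : E2}
    (hy : y ∈ W) {v : E3} (hv : ⟪v, normal Ω (φ y)⟫ = 0) : ⟪v, chartNormal φ y⟫ = 0 := by
  rw [chartNormal, real_inner_smul_right,
    eq_inner_smul_of_orthogonal (hΩ.norm_normal (h.mapsTo y hy).1) (h.inner_normal_fderiv hΩ hy _)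
      (h.inner_normal_fderiv hΩ hy _), real_inner_smul_right, hv, mul_zero, mul_zero]

/-- In a chart the surface divergence of a tangential field is a planar divergence. -/
theorem areaElement_mul_divS (h : IsSurfaceChart Ω O W φ θ) (hΩ : IsSmoothDomain Ω) {w : E3 → E3}
    (hw : ContDiffOn ℝ 1 w (frontier Ω)) (ht : IsTangential Ω w) {y : E2} (hy : y ∈ W) :
    areaElement φ y * divS Ω w (φ y) =
      fderiv ℝ (fun z => ⟪chartNormal φ z,
        crossL (w (φ z)) (fderiv ℝ φ z (EuclideanSpace.single 1 1))⟫) y (EuclideanSpace.single 0 1)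
      + fderiv ℝ (fun z => ⟪chartNormal φ z,
        crossL (fderiv ℝ φ z (EuclideanSpace.single 0 1)) (w (φ z))⟫) y
        (EuclideanSpace.single 1 1) := by
  set e₀ : E2 := EuclideanSpace.single 0 1
  set e₁ : E2 := EuclideanSpace.single 1 1
  have hWy : W ∈ 𝓝 y := h.patch.isOpen.mem_nhds hy
  have hx : φ y ∈ frontier Ω := (h.mapsTo y hy).1
  obtain ⟨A, hA⟩ := hw.differentiableOn (by simp) (φ y) hx
  have hφ : HasFDerivAt φ (fderiv ℝ φ y) y := (h.patch.hasStrictFDerivAt hy).hasFDerivAt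
  have hwφ : HasFDerivAt (fun z => w (φ z)) (A.comp (fderiv ℝ φ y)) y :=
    hA.comp_hasFDerivAt y hφ (Filter.eventually_of_mem hWy fun z hz => (h.mapsTo z hz).1)
  have hD : HasFDerivAt (fderiv ℝ φ) (fderiv ℝ (fderiv ℝ φ) y) y :=
    (((h.contDiffOn.fderiv_of_isOpen (m := 1) h.patch.isOpen (by norm_num)).contDiffAt
      hWy).differentiableAt (by simp)).hasFDerivAt
  have hDe : ∀ e, HasFDerivAt (fun z => fderiv ℝ φ z e)
      ((ContinuousLinearMap.apply ℝ E3 e).comp (fderiv ℝ (fderiv ℝ φ) y)) y := fun e =>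
    (ContinuousLinearMap.apply ℝ E3 e).hasFDerivAt.comp y hD
  have hsymm : fderiv ℝ (fderiv ℝ φ) y e₀ e₁ = fderiv ℝ (fderiv ℝ φ) y e₁ e₀ :=
    (h.contDiffOn.contDiffAt hWy).isSymmSndFDerivAt (by simp) e₀ e₁
  have hN : HasFDerivAt (chartNormal φ) (fderiv ℝ (chartNormal φ) y) y :=
    ((h.contDiffOn_chartNormal.contDiffAt hWy).differentiableAt (by simp)).hasFDerivAt
  have hNN : ∀ e, ⟪fderiv ℝ (chartNormal φ) y e, chartNormal φ y⟫ = 0 := by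
    intro e
    have h1 := hN.inner ℝ hN
    have h2 : (fun z => ⟪chartNormal φ z, chartNormal φ z⟫) =ᶠ[𝓝 y] fun _ => 1 := by
      filter_upwards [hWy] with z hz using h.inner_chartNormal_self hz
    have h3 := (h1.congr_of_eventuallyEq h2.symm).unique (hasFDerivAt_const (1 : ℝ) y)
    have h4 := congrArg (fun B : E2 →L[ℝ] ℝ => B e) h3
    simp [fderivInnerCLM_apply] at h4
    rw [real_inner_comm (fderiv ℝ (chartNormal φ) y e)] at h4
    linarith
  have hN0 : chartNormal φ y ≠ 0 := by
    intro h0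
    have := h.inner_chartNormal_self hy
    rw [h0, inner_zero_left] at this
    exact zero_ne_one this
  have hφN : ∀ e, ⟪fderiv ℝ φ y e, chartNormal φ y⟫ = 0 := fun e =>
    h.inner_chartNormal hΩ hy (h.inner_normal_fderiv hΩ hy e)
  have hwN : ⟪w (φ y), chartNormal φ y⟫ = 0 := h.inner_chartNormal hΩ hy (ht _ hx)
  -- The terms that differentiate N are triple products of tangent vectors, because |N| = 1 makes
  -- its derivatives tangential; they vanish. The terms with ∂₀∂₁φ cancel by symmetry of second
  -- derivatives, leaving only derivatives of w.
  rw [fderiv_inner_crossL hN hwφ (hDe e₁), fderiv_inner_crossL hN (hDe e₀) hwφ,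
    inner_crossL_eq_zero hN0 (hNN e₀) hwN (hφN e₁), inner_crossL_eq_zero hN0 (hNN e₁) (hφN e₀) hwN]
  simp only [ContinuousLinearMap.comp_apply, ContinuousLinearMap.apply_apply]
  rw [hsymm, crossL_swap (w (φ y)), inner_neg_right]
  have key := inner_crossL_map_add_eq_tr (hΩ.norm_normal hx) A (h.inner_normal_fderiv hΩ hy e₀)
    (h.inner_normal_fderiv hΩ hy e₁)
  have hJ : areaElement φ y = ‖crossL (fderiv ℝ φ y e₀) (fderiv ℝ φ y e₁)‖ := areaElement_eq φ y
  have hJ0 : areaElement φ y ≠ 0 := (h.patch.areaElement_pos hy).ne'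
  rw [← hΩ.divP_eq hx hA, ← hJ] at key
  change _ * divP Ω w (φ y) = _
  have hNe : chartNormal φ y = (areaElement φ y)⁻¹ • crossL (fderiv ℝ φ y e₀) (fderiv ℝ φ y e₁) :=
    rfl
  have e1 : ∀ v, ⟪chartNormal φ y, v⟫ =
      (areaElement φ y)⁻¹ * ⟪crossL (fderiv ℝ φ y e₀) (fderiv ℝ φ y e₁), v⟫ := fun v => by
    rw [hNe, real_inner_smul_left]
  simp only [e1]
  field_simp
  linear_combination -key

/-- The divergence theorem for tangential fields supported in a chart. -/
theorem integral_divS_eq_zero (h : IsSurfaceChart Ω O W φ θ) (hΩ : IsSmoothDomain Ω) {w : E3 → E3}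
    (hw : ContDiffOn ℝ 1 w (frontier Ω)) (ht : IsTangential Ω w) {C : Set E3} (hC : IsCompact C)
    (hCS : C ⊆ frontier Ω) (hCO : C ⊆ O) (h0 : ∀ x ∈ frontier Ω, x ∉ C → w x = 0) :
    ∫ x, divS Ω w x ∂surfaceMeasure Ω = 0 := by
  have hdiv0 : ∀ x ∈ frontier Ω, x ∉ C → divS Ω w x = 0 := by
    intro x hx hxC
    have hz : HasFDerivWithinAt w (0 : E3 →L[ℝ] E3) (frontier Ω) x := by
      refine (hasFDerivWithinAt_const (0 : E3) x (frontier Ω)).congr_of_eventuallyEq ?_ (h0 x hx hxC)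
      filter_upwards [mem_nhdsWithin_of_mem_nhds (hC.isClosed.isOpen_compl.mem_nhds hxC),
        self_mem_nhdsWithin] with z hz hzS using h0 z hzS hz
    refine (hΩ.divP_eq hx hz).trans ?_
    simp [tr]
  -- Off C both w and its divergence vanish, so only the part of the surface inside the chart
  -- contributes.
  have h1 : ∫ x, divS Ω w x ∂surfaceMeasure Ω =
      ∫ x in φ '' W, divS Ω w x ∂(Measure.euclideanHausdorffMeasure 2 : Measure E3) := by
    rw [h.image_eq, surfaceMeasure]
    refine (setIntegral_eq_of_subset_of_forall_sdiff_eq_zero isClosed_frontier.measurableSet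
      inter_subset_left fun x hx => ?_)
    exact hdiv0 x hx.1 fun hxC => hx.2 ⟨hx.1, hCO hxC⟩
  obtain ⟨hK, hKW⟩ := h.isCompact_preimage hC hCO hCS
  have hwφ : ContDiffOn ℝ 1 (fun z => w (φ z)) W :=
    hw.comp (h.contDiffOn.of_le (by norm_num)) fun y hy => (h.mapsTo y hy).1
  have hw0 : ∀ y ∈ W, y ∉ θ '' C → w (φ y) = 0 := fun y hy hyK =>
    h0 _ (h.mapsTo y hy).1 fun hc => hyK ⟨φ y, hc, h.leftInv y hy⟩
  obtain ⟨i1, z1⟩ := setIntegral_fderiv_eq_zero h.patch.isOpen hK hKW (contDiffOn_inner_crossL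
    h.contDiffOn_chartNormal hwφ (h.contDiffOn_fderiv_apply (EuclideanSpace.single 1 1)))
    (fun y hy hyK => by simp [hw0 y hy hyK]) (EuclideanSpace.single 0 1)
  obtain ⟨i2, z2⟩ := setIntegral_fderiv_eq_zero h.patch.isOpen hK hKW (contDiffOn_inner_crossL
    h.contDiffOn_chartNormal (h.contDiffOn_fderiv_apply (EuclideanSpace.single 0 1)) hwφ)
    (fun y hy hyK => by simp [hw0 y hy hyK]) (EuclideanSpace.single 1 1)
  rw [h1, h.patch.integral_image subset_rfl h.patch.isOpen.measurableSet]
  simp only [smul_eq_mul]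
  rw [setIntegral_congr_fun h.patch.isOpen.measurableSet fun y hy =>
      h.areaElement_mul_divS hΩ hw ht hy, integral_add i1 i2, z1, z2, add_zero]

end IsSurfaceChart

/-- Smooth partitions of unity on a compact set subordinate to a neighbourhood of each point. -/
theorem exists_finite_partition {S : Set E3} (hS : IsCompact S) {O : S → Set E3}
    (hO : ∀ x, IsOpen (O x)) (hxO : ∀ x : S, (x : E3) ∈ O x) :
    ∃ (t : Finset S) (χ : S → E3 → ℝ), (∀ i, ContDiff ℝ ∞ (χ i)) ∧ (∀ i, tsupport (χ i) ⊆ O i) ∧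
      ∀ x ∈ S, ∑ i ∈ t, χ i x = 1 := by
  obtain ⟨f, hf⟩ := SmoothPartitionOfUnity.exists_isSubordinate (modelWithCornersSelf ℝ E3)
    hS.isClosed O hO fun x hx => mem_iUnion.2 ⟨⟨x, hx⟩, hxO ⟨x, hx⟩⟩
  have hfin := f.locallyFinite.finite_nonempty_inter_compact hS
  refine ⟨hfin.toFinset, fun i => f i, fun i => (f i).contMDiff.contDiff, hf, fun x hx => ?_⟩
  rw [← f.sum_eq_one hx]
  refine (finsum_eq_sum_of_support_subset _ fun i hi => ?_).symm
  simp only [Finite.coe_toFinset, mem_ofPred_eq]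
  exact ⟨x, hi, hx⟩

/-- **Divergence theorem** on a closed surface. -/
theorem IsSmoothDomain.integral_divS_eq_zero {Ω : Set E3} (hΩ : IsSmoothDomain Ω) {w : E3 → E3}
    (hw : ContDiffOn ℝ 1 w (frontier Ω)) (ht : IsTangential Ω w) :
    ∫ x, divS Ω w x ∂surfaceMeasure Ω = 0 := by
  choose O W φ θ hxO hch using fun x : frontier Ω => hΩ.exists_surfaceChart x.2
  obtain ⟨t, χ, hχ, hsupp, hsum⟩ := exists_finite_partition hΩ.isCompact_frontier
    (fun x => (hch x).isOpen_target) hxO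
  have hχw : ∀ i, ContDiffOn ℝ 1 (fun x => χ i x • w x) (frontier Ω) := fun i =>
    ((hχ i).of_le (by simp)).contDiffOn.smul hw
  have hsplit : EqOn (divS Ω w) (fun x => ∑ i ∈ t, divS Ω (fun x => χ i x • w x) x)
      (frontier Ω) := by
    intro x hx
    beta_reduce
    rw [← hΩ.divS_sum t hx fun i _ => (hχw i).differentiableOn (by simp) x hx]
    refine divS_congr (fun z hz => ?_) hx
    simp only [← Finset.sum_smul, hsum z hz, one_smul]
  rw [integral_surface_congr hsplit, integral_finsetSum]
  · refine Finset.sum_eq_zero fun i _ => ?_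
    refine (hch i).integral_divS_eq_zero hΩ (hχw i) (fun x hx => ?_)
      (hΩ.isCompact_frontier.inter_right (isClosed_tsupport (χ i))) inter_subset_left
      (inter_subset_right.trans (hsupp i)) fun x hx hxC => ?_
    · rw [real_inner_smul_left, ht x hx, mul_zero]
    · rw [image_eq_zero_of_notMem_tsupport fun hc => hxC ⟨hx, hc⟩, zero_smul]
  · exact fun i _ => hΩ.integrable_of_continuousOn (hΩ.continuousOn_divP (hχw i))

/-! ### The integral identity and H¹ regularity -/

namespace IsSmoothDomain
variable {Ω : Set E3}

/-- A continuously differentiable function on the surface is in `H¹`. -/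
theorem memH1_of_contDiffOn (hΩ : IsSmoothDomain Ω) {v : E3 → ℝ}
    (hv : ContDiffOn ℝ 1 v (frontier Ω)) : MemH1 Ω v := by
  have hg : ContinuousOn (fun x => (InnerProductSpace.toDual ℝ E3).symm (gradC Ω v x))
      (frontier Ω) :=
    (InnerProductSpace.toDual ℝ E3).symm.continuous.comp_continuousOn (hΩ.continuousOn_gradC hv)
  refine ⟨hΩ.memLp_of_continuousOn hv.continuousOn 2, _, hΩ.memLp_of_continuousOn hg 2, ?_, ?_⟩
  · refine (ae_restrict_iff' isClosed_frontier.measurableSet).2 (Eventually.of_forall fun x hx => ?_)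
    rw [InnerProductSpace.toDual_symm_apply, gradC, ContinuousLinearMap.comp_apply,
      hΩ.proj_normal hx, map_zero]
  · intro w hw ht
    have hw1 : ContDiffOn ℝ 1 w (frontier Ω) := hw.of_le (by simp)
    -- Integration by parts is the divergence theorem for v w combined with the product rule.
    have h0 := hΩ.integral_divS_eq_zero (w := fun x => v x • w x) (hv.smul hw1) fun x hx => by
      rw [real_inner_smul_left, ht x hx, mul_zero]
    rw [integral_surface_congr fun x hx => hΩ.divS_smul hx (hv.differentiableOn (by simp) x hx)
      (hw1.differentiableOn (by simp) x hx) (ht x hx), integral_add] at h0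
    · simp only [InnerProductSpace.toDual_symm_apply]
      linarith
    · exact hΩ.integrable_of_continuousOn (hv.continuousOn.mul (hΩ.continuousOn_divP hw1))
    · exact hΩ.integrable_of_continuousOn
        ((hΩ.continuousOn_gradC hv).clm_apply hw1.continuousOn)

/-- The total surface divergence of a vector field is minus the integral of its normal component
against the mean curvature. -/
theorem integral_divP (hΩ : IsSmoothDomain Ω) {u : E3 → E3} (hu : ContDiffOn ℝ 1 u (frontier Ω))
    {v : E3 → ℝ} (huv : ∀ x ∈ frontier Ω, ⟪u x, normal Ω x⟫ = v x) :
    Integrable (fun x => v x * meanCurvature Ω x) (surfaceMeasure Ω) ∧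
    Integrable (divS Ω (tangentialPart Ω u)) (surfaceMeasure Ω) ∧
    ∫ x, divP Ω u x ∂surfaceMeasure Ω =
      ∫ x, (divS Ω (tangentialPart Ω u) x - v x * meanCurvature Ω x) ∂surfaceMeasure Ω ∧
    ∫ x, (divS Ω (tangentialPart Ω u) x - v x * meanCurvature Ω x) ∂surfaceMeasure Ω =
      -∫ x, v x * meanCurvature Ω x ∂surfaceMeasure Ω := by
  have hν : ContDiffOn ℝ 1 (normal Ω) (frontier Ω) := hΩ.contDiffOn_normal.of_le (by simp)
  have hv : ContDiffOn ℝ 1 v (frontier Ω) := (hu.inner ℝ hν).congr fun x hx => (huv x hx).symm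
  have i1 : Integrable (fun x => v x * meanCurvature Ω x) (surfaceMeasure Ω) :=
    hΩ.integrable_of_continuousOn (hv.continuousOn.mul hΩ.continuousOn_meanCurvature)
  have hP := hΩ.contDiffOn_tangentialPart hu
  have i2 : Integrable (divS Ω (tangentialPart Ω u)) (surfaceMeasure Ω) :=
    hΩ.integrable_of_continuousOn (hΩ.continuousOn_divP hP)
  refine ⟨i1, i2, integral_surface_congr fun x hx => ?_, ?_⟩
  · rw [hΩ.divP_eq_divS_sub hx (hu.differentiableOn (by simp) x hx), huv x hx]
  · rw [integral_sub i2 i1, hΩ.integral_divS_eq_zero hP (hΩ.isTangential_tangentialPart u),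
      zero_sub]

end IsSmoothDomain

namespace IsInextensibleVelocity
variable {Ω : Set E3} {v : E3 → ℝ} {u : E3 → E3}

theorem integral_divP_eq_zero (h : IsInextensibleVelocity Ω v u) :
    ∫ x, divP Ω u x ∂surfaceMeasure Ω = 0 := by
  rw [integral_surface_congr (g := fun _ => (0 : ℝ)) h.divP_eq_zero]; simp

theorem integral_mul_meanCurvature_eq_zero (h : IsInextensibleVelocity Ω v u)
    (hΩ : IsSmoothDomain Ω) : ∫ x, v x * meanCurvature Ω x ∂surfaceMeasure Ω = 0 := by
  obtain ⟨-, -, h1, h2⟩ := hΩ.integral_divP h.contDiffOn h.inner_normal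
  rw [h2, h.integral_divP_eq_zero] at h1
  linarith

theorem memH1 (h : IsInextensibleVelocity Ω v u) (hΩ : IsSmoothDomain Ω) : MemH1 Ω v :=
  hΩ.memH1_of_contDiffOn <| (h.contDiffOn.inner ℝ (hΩ.contDiffOn_normal.of_le (by simp))).congr
    fun x hx => (h.inner_normal x hx).symm

end IsInextensibleVelocity

/-! ### Surface diffeomorphisms and the velocity field -/

/-- A continuous map sends closed subsets of a compact set to compact, hence closed, sets; these are
the preimages under the inverse. -/
theorem continuousOn_invFunOn_of_isCompact {Y : E3 → E3} {S T : Set E3} (hS : IsCompact S)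
    (hY : ContinuousOn Y S) (hb : BijOn Y S T) : ContinuousOn (Function.invFunOn Y S) T := by
  rw [continuousOn_iff_isClosed]
  intro C hC
  refine ⟨Y '' (S ∩ C), ((hS.inter_right hC).image_of_continuousOn
    (hY.mono inter_subset_left)).isClosed, ?_⟩
  ext x
  constructor
  · rintro ⟨hxC, hxT⟩
    exact ⟨⟨_, ⟨hb.surjOn.mapsTo_invFunOn hxT, hxC⟩, hb.surjOn.rightInvOn_invFunOn hxT⟩, hxT⟩
  · rintro ⟨⟨p, ⟨hp, hpC⟩, rfl⟩, hxT⟩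
    refine ⟨?_, hxT⟩
    rw [mem_preimage, hb.injOn.leftInvOn_invFunOn hp]
    exact hpC

theorem exists_leftInverse_continuousLinearMap {L : E2 →L[ℝ] E3} (hL : Function.Injective L) :
    ∃ g : E3 →L[ℝ] E2, g.comp L = ContinuousLinearMap.id ℝ E2 := by
  obtain ⟨g, hg⟩ := LinearMap.exists_leftInverse_of_injective (L : E2 →ₗ[ℝ] E3)
    (LinearMap.ker_eq_bot.2 hL)
  refine ⟨LinearMap.toContinuousLinearMap g, ?_⟩
  ext1 y
  exact congrArg (fun A : E2 →ₗ[ℝ] E2 => A y) hg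

/-- `Y` is a smooth bijective immersion of the surface `frontier Ω₀` onto the surface
`frontier Ω₁`. -/
structure IsSurfaceDiffeo (Ω₀ Ω₁ : Set E3) (Y : E3 → E3) : Prop where
  source : IsSmoothDomain Ω₀
  target : IsSmoothDomain Ω₁
  contDiffOn : ContDiffOn ℝ ∞ Y (frontier Ω₀)
  bijOn : BijOn Y (frontier Ω₀) (frontier Ω₁)
  immersion : ∀ p ∈ frontier Ω₀, ∀ z : E3, ⟪z, normal Ω₀ p⟫ = 0 → gradC Ω₀ Y p z = 0 → z = 0

namespace IsSurfaceDiffeo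
variable {Ω₀ Ω₁ : Set E3} {Y : E3 → E3} {O : Set E3} {W : Set E2} {ψ : E2 → E3} {θ : E3 → E2}

theorem contDiffOn_comp (h : IsSurfaceDiffeo Ω₀ Ω₁ Y) (hψ : IsSurfaceChart Ω₀ O W ψ θ) :
    ContDiffOn ℝ 2 (fun y => Y (ψ y)) W :=
  (h.contDiffOn.of_le ENat.LEInfty.out).comp hψ.contDiffOn fun y hy => (hψ.mapsTo y hy).1

theorem isImmersedPatch (h : IsSurfaceDiffeo Ω₀ Ω₁ Y) (hψ : IsSurfaceChart Ω₀ O W ψ θ) :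
    IsImmersedPatch W fun y => Y (ψ y) := by
  refine ⟨hψ.patch.isOpen, (h.contDiffOn_comp hψ).of_le (by norm_num),
    h.bijOn.injOn.comp hψ.patch.injOn fun y hy => (hψ.mapsTo y hy).1, fun y hy => ?_⟩
  have hx := (hψ.mapsTo y hy).1
  have hA := (h.contDiffOn.differentiableOn (by simp) (ψ y) hx).hasFDerivWithinAt
  have hd : HasFDerivAt (fun y => Y (ψ y)) _ y :=
    hA.comp_hasFDerivAt y (hψ.patch.hasStrictFDerivAt hy).hasFDerivAt
      (Filter.eventually_of_mem (hψ.patch.isOpen.mem_nhds hy) fun z hz => (hψ.mapsTo z hz).1)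
  rw [hd.fderiv, injective_iff_map_eq_zero]
  intro e he
  have ht := hψ.inner_normal_fderiv h.source hy e
  refine (injective_iff_map_eq_zero _).1 (hψ.patch.injective y hy) e
    (h.immersion _ hx _ ht ?_)
  rw [gradC, ContinuousLinearMap.comp_apply, proj_eq_self ht]
  exact he

/-- The inverse of a bijective immersion between closed surfaces is continuously differentiable. -/
theorem contDiffOn_inv (h : IsSurfaceDiffeo Ω₀ Ω₁ Y) :
    ContDiffOn ℝ 1 (Function.invFunOn Y (frontier Ω₀)) (frontier Ω₁) := by
  intro x hx
  set inv := Function.invFunOn Y (frontier Ω₀)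
  have hinv : ∀ z ∈ frontier Ω₁, inv z ∈ frontier Ω₀ := fun z hz =>
    h.bijOn.surjOn.mapsTo_invFunOn hz
  have hYinv : ∀ z ∈ frontier Ω₁, Y (inv z) = z := fun z hz =>
    h.bijOn.surjOn.rightInvOn_invFunOn hz
  have hc : ContinuousWithinAt inv (frontier Ω₁) x :=
    continuousOn_invFunOn_of_isCompact h.source.isCompact_frontier h.contDiffOn.continuousOn
      h.bijOn x hx
  obtain ⟨O, W, ψ, θ, hpO, hψ⟩ := h.source.exists_surfaceChart (hinv x hx)
  have hy₀ : θ (inv x) ∈ W := hψ.inv_mapsTo _ ⟨hinv x hx, hpO⟩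
  have hW : W ∈ 𝓝 (θ (inv x)) := hψ.patch.isOpen.mem_nhds hy₀
  have hpatch := h.isImmersedPatch hψ
  -- Composing with a left inverse g of the derivative turns Y ∘ ψ into a planar map with identity
  -- derivative. If k is its local inverse, then Y⁻¹ = ψ ∘ k ∘ g on the surface near x; continuity
  -- of Y⁻¹ keeps nearby points in the same chart.
  obtain ⟨g, hg⟩ := exists_leftInverse_continuousLinearMap (hpatch.injective _ hy₀)
  have hx₀ : Y (ψ (θ (inv x))) = x := by rw [hψ.rightInv _ ⟨hinv x hx, hpO⟩, hYinv x hx]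
  have hG : ContDiffAt ℝ 1 (fun y => g (Y (ψ y))) (θ (inv x)) :=
    g.contDiff.contDiffAt.comp _ (hpatch.contDiffOn.contDiffAt hW)
  have hG' : HasFDerivAt (fun y => g (Y (ψ y)))
      ((ContinuousLinearEquiv.refl ℝ E2 : E2 ≃L[ℝ] E2) : E2 →L[ℝ] E2) (θ (inv x)) := by
    have := g.hasFDerivAt.comp _ (hpatch.hasStrictFDerivAt hy₀).hasFDerivAt
    rwa [hg] at this
  have hk := hG.to_localInverse hG' (by simp)
  have hkl := (hG.hasStrictFDerivAt' hG' (by simp)).eventually_left_inverse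
  set k := hG.localInverse hG' (by simp)
  have hkx : k (g x) = θ (inv x) := by
    have := hG.localInverse_apply_image hG' (by simp)
    simpa only [hx₀] using this
  simp only [hx₀] at hk
  have hcomp : ContDiffAt ℝ 1 (fun z => ψ (k (g z))) x := by
    refine ContDiffAt.comp x ?_ (hk.comp x g.contDiff.contDiffAt)
    rw [hkx]
    exact hψ.patch.contDiffOn.contDiffAt hW
  refine hcomp.contDiffWithinAt.congr_of_eventuallyEq ?_ ?_
  · have hθ : ContinuousWithinAt (fun z => θ (inv z)) (frontier Ω₁) x :=
      (hψ.continuousOn_inv.continuousAt (hψ.isOpen_target.mem_nhds hpO)).comp_continuousWithinAt hc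
    filter_upwards [hc (hψ.isOpen_target.mem_nhds hpO), hθ.eventually hkl, self_mem_nhdsWithin]
      with z hzO hzk hz
    have e1 : ψ (θ (inv z)) = inv z := hψ.rightInv _ ⟨hinv z hz, hzO⟩
    rw [e1, hYinv z hz] at hzk
    change k (g z) = _ at hzk
    rw [hzk, e1]
  · rw [hkx, hψ.rightInv _ ⟨hinv x hx, hpO⟩]

end IsSurfaceDiffeo

namespace IsEvolvingSurface
variable {I : Set ℝ} {Ωref : Set E3} {Ω : ℝ → Set E3} {X : ℝ → E3 → E3}

theorem isSurfaceDiffeo (hS : IsEvolvingSurface I Ωref Ω X) {t : ℝ} (ht : t ∈ I) :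
    IsSurfaceDiffeo Ωref (Ω t) (X t) where
  source := hS.reference
  target := hS.domain t ht
  contDiffOn := hS.contDiffOn.comp (contDiffOn_const.prodMk contDiffOn_id) fun _ hp => ⟨ht, hp⟩
  bijOn := hS.bijOn t ht
  immersion := hS.immersion t ht

/-- Joint derivatives on I × S are not unique in the normal direction, but the time direction (1, 0)
is unaffected. Any local C¹ family of derivatives therefore computes the time derivative. -/
theorem contDiffOn_derivWithin (hS : IsEvolvingSurface I Ωref Ω X) (hI : UniqueDiffOn ℝ I)
    {t : ℝ} (ht : t ∈ I) :
    ContDiffOn ℝ 1 (fun p => derivWithin (fun s => X s p) I t) (frontier Ωref) := by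
  intro p hp
  have hmem : (t, p) ∈ I ×ˢ frontier Ωref := ⟨ht, hp⟩
  obtain ⟨u, hu, -, -, F', hF', hc⟩ :=
    (contDiffWithinAt_succ_iff_hasFDerivWithinAt' (n := 1) (by simp)).1
      ((hS.contDiffOn.of_le (m := 2) ENat.LEInfty.out) (t, p) hmem)
  rw [insert_eq_of_mem hmem] at hu
  have hslice : ContDiffWithinAt ℝ 1 (fun q : E3 => (t, q)) (frontier Ωref) p :=
    contDiffWithinAt_const.prodMk contDiffWithinAt_id
  have hmaps : MapsTo (fun q : E3 => (t, q)) (frontier Ωref) (I ×ˢ frontier Ωref) :=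
    fun q hq => ⟨ht, hq⟩
  have h1 : ContDiffWithinAt ℝ 1 (fun q => F' (t, q) (1, 0)) (frontier Ωref) p :=
    (hc.comp p hslice hmaps).clm_apply contDiffWithinAt_const
  have h2 : ∀ q ∈ frontier Ωref, (t, q) ∈ u →
      derivWithin (fun s => X s q) I t = F' (t, q) (1, 0) := fun q hq hqu => by
    have hl : HasDerivWithinAt (fun s : ℝ => (s, q)) ((1 : ℝ), (0 : E3)) I t :=
      (hasDerivWithinAt_id t I).prodMk (hasDerivWithinAt_const t I q)
    have hm : MapsTo (fun s : ℝ => (s, q)) I (I ×ˢ frontier Ωref) := fun s hs => ⟨hs, hq⟩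
    have := (hF' (t, q) hqu).comp_hasDerivWithinAt t hl hm
    exact this.derivWithin (hI t ht)
  refine h1.congr_of_eventuallyEq ?_ (h2 p hp (mem_of_mem_nhdsWithin hmem hu))
  filter_upwards [hslice.continuousWithinAt.tendsto_nhdsWithin hmaps hu, self_mem_nhdsWithin]
    with q hqu hq using h2 q hq hqu

/-- The velocity field of an evolving surface. -/
def velocity (I : Set ℝ) (Ωref : Set E3) (X : ℝ → E3 → E3) (t : ℝ) (x : E3) : E3 :=
  derivWithin (fun s => X s (Function.invFunOn (X t) (frontier Ωref) x)) I t

theorem velocity_apply (hS : IsEvolvingSurface I Ωref Ω X) {t : ℝ} (ht : t ∈ I) {p : E3}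
    (hp : p ∈ frontier Ωref) :
    velocity I Ωref X t (X t p) = derivWithin (fun s => X s p) I t := by
  rw [velocity, (hS.bijOn t ht).injOn.leftInvOn_invFunOn hp]

theorem contDiffOn_velocity (hS : IsEvolvingSurface I Ωref Ω X) (hI : UniqueDiffOn ℝ I)
    {t : ℝ} (ht : t ∈ I) : ContDiffOn ℝ 1 (velocity I Ωref X t) (frontier (Ω t)) :=
  (hS.contDiffOn_derivWithin hI ht).comp (hS.isSurfaceDiffeo ht).contDiffOn_inv
    (hS.bijOn t ht).surjOn.mapsTo_invFunOn

theorem inner_velocity_normal (hS : IsEvolvingSurface I Ωref Ω X) {V : ℝ → E3 → ℝ}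
    (hV : HasNormalVelocity I Ωref Ω X V) {t : ℝ} (ht : t ∈ I) :
    ∀ x ∈ frontier (Ω t), ⟪velocity I Ωref X t x, normal (Ω t) x⟫ = V t x := by
  intro x hx
  obtain ⟨p, hp, rfl⟩ := (hS.bijOn t ht).surjOn hx
  rw [hS.velocity_apply ht hp, hV t ht p hp]

end IsEvolvingSurface

/-! ### First variation of area -/

/-- Differentiation under the integral sign over a compact set, with a one-sided derivative at the
endpoints of the interval of parameters. -/
theorem hasDerivWithinAt_setIntegral {I : Set ℝ} (hI : I.OrdConnected) {W K : Set E2}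
    (hW : IsOpen W) (hK : IsCompact K) (hKW : K ⊆ W) {J J' : ℝ → E2 → ℝ}
    (hJ : ∀ s ∈ I, ContinuousOn (J s) W)
    (hJ' : ∀ s ∈ I, ∀ y ∈ W, HasDerivWithinAt (fun s => J s y) (J' s y) I s)
    (hc : ContinuousOn (fun q : ℝ × E2 => J' q.1 q.2) (I ×ˢ W)) {t : ℝ} (ht : t ∈ I) :
    HasDerivWithinAt (fun s => ∫ y in K, J s y) (∫ y in K, J' t y) I t := by
  have hcK : ContinuousOn (J' t) K :=
    (hc.comp (Continuous.prodMk_right t).continuousOn fun y hy => ⟨ht, hKW hy⟩ :)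
  obtain ⟨C, hC⟩ := hK.exists_bound_of_continuousOn hcK
  -- The bound C at time t persists, up to 1, on a time neighbourhood uniform in y ∈ K. By the mean
  -- value inequality C + 1 then dominates the difference quotients.
  have hloc : ∀ᶠ s in 𝓝 t, ∀ y ∈ K, s ∈ I → ‖J' s y‖ ≤ C + 1 := by
    refine hK.eventually_forall_of_forall_eventually fun y hy => ?_
    have h1 := (hc (t, y) ⟨ht, hKW hy⟩).norm.eventually
      (gt_mem_nhds (lt_of_le_of_lt (hC y hy) (lt_add_one C)))
    filter_upwards [eventually_nhdsWithin_iff.1 h1,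
      (continuous_snd.tendsto (t, y)).eventually (hW.mem_nhds (hKW hy))] with q hq hqW hqI
    exact (hq ⟨hqI, hqW⟩).le
  obtain ⟨δ, hδ, hball⟩ := Metric.eventually_nhds_iff_ball.1 hloc
  rw [hasDerivWithinAt_iff_tendsto_slope]
  have hint : ∀ s ∈ I, IntegrableOn (J s) K := fun s hs =>
    ((hJ s hs).mono hKW).integrableOn_compact hK
  have hslope : (fun s => ∫ y in K, slope (fun s => J s y) t s) =ᶠ[𝓝[I \ {t}] t]
      slope (fun s => ∫ y in K, J s y) t := by
    filter_upwards [self_mem_nhdsWithin] with s hs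
    simp only [slope, vsub_eq_sub, smul_eq_mul]
    rw [integral_const_mul, integral_sub (hint s hs.1) (hint t ht)]
  refine Tendsto.congr' hslope ?_
  refine tendsto_integral_filter_of_dominated_convergence (fun _ => C + 1) ?_ ?_ ?_ ?_
  · filter_upwards [self_mem_nhdsWithin] with s hs
    simp only [slope, vsub_eq_sub, smul_eq_mul]
    exact (((hint s hs.1).sub (hint t ht)).const_mul _).aestronglyMeasurable
  · filter_upwards [self_mem_nhdsWithin, mem_nhdsWithin_of_mem_nhds (Metric.ball_mem_nhds t hδ)]
      with s hs hsb
    refine (ae_restrict_iff' hK.measurableSet).2 (Eventually.of_forall fun y hy => ?_)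
    have hconv : Convex ℝ (I ∩ Metric.ball t δ) := hI.convex.inter (convex_ball t δ)
    have := hconv.norm_image_sub_le_of_norm_hasDerivWithin_le
      (f := fun s => J s y) (f' := fun s => J' s y) (C := C + 1)
      (fun r hr => (hJ' r hr.1 y (hKW hy)).mono inter_subset_left)
      (fun r hr => hball r hr.2 y hy hr.1) ⟨ht, Metric.mem_ball_self hδ⟩ ⟨hs.1, hsb⟩
    have hst : 0 < ‖s - t‖ := norm_pos_iff.2 (sub_ne_zero.2 hs.2)
    rw [slope_def_field, norm_div, div_le_iff₀ hst]
    exact this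
  · exact integrableOn_const hK.measure_lt_top.ne
  · refine (ae_restrict_iff' hK.measurableSet).2 (Eventually.of_forall fun y hy => ?_)
    exact hasDerivWithinAt_iff_tendsto_slope.1 (hJ' t ht y (hKW hy))

theorem HasDerivWithinAt.norm_crossL {a b : ℝ → E3} {a' b' : E3} {I : Set ℝ} {t : ℝ}
    (ha : HasDerivWithinAt a a' I t) (hb : HasDerivWithinAt b b' I t)
    (h0 : crossL (a t) (b t) ≠ 0) :
    HasDerivWithinAt (fun s => ‖crossL (a s) (b s)‖)
      (‖crossL (a t) (b t)‖⁻¹ * (⟪crossL (a t) (b t), crossL a' (b t)⟫ +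
        ⟪crossL (a t) (b t), crossL (a t) b'⟫)) I t := by
  have hc : HasDerivWithinAt (fun s => crossL (a s) (b s))
      (crossL a' (b t) + crossL (a t) b') I t :=
    (crossL.hasFDerivAt.comp_hasDerivWithinAt t ha).clm_apply hb
  have hs := hc.norm_sq.sqrt (by positivity)
  have hpos : 0 < ‖crossL (a t) (b t)‖ := norm_pos_iff.2 h0
  simp only [Real.sqrt_sq (norm_nonneg _)] at hs
  convert! hs using 1
  rw [inner_add_right]
  field_simp

/-- Surface integrals through a parametrization and a partition of unity. -/
theorem IsSurfaceDiffeo.integral_eq_sum {Ω₀ Ω₁ : Set E3} {Y : E3 → E3}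
    (h : IsSurfaceDiffeo Ω₀ Ω₁ Y) {ι : Type*} {s : Finset ι} {χ : ι → E3 → ℝ}
    (hχ : ∀ i, Continuous (χ i)) (hsum : ∀ x ∈ frontier Ω₀, ∑ i ∈ s, χ i x = 1)
    {O : ι → Set E3} {W : ι → Set E2} {ψ : ι → E2 → E3} {θ : ι → E3 → E2}
    (hψ : ∀ i, IsSurfaceChart Ω₀ (O i) (W i) (ψ i) (θ i)) (hsupp : ∀ i, tsupport (χ i) ⊆ O i)
    {g : E3 → ℝ} (hg : ContinuousOn g (frontier Ω₁)) :
    ∫ x, g x ∂surfaceMeasure Ω₁ = ∑ i ∈ s, ∫ y in θ i '' (frontier Ω₀ ∩ tsupport (χ i)),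
      χ i (ψ i y) * (areaElement (fun y => Y (ψ i y)) y * g (Y (ψ i y))) := by
  set inv := Function.invFunOn Y (frontier Ω₀)
  have hinv : ContinuousOn inv (frontier Ω₁) := h.contDiffOn_inv.continuousOn
  have hinvY : ∀ p ∈ frontier Ω₀, inv (Y p) = p := fun p hp => h.bijOn.injOn.leftInvOn_invFunOn hp
  have hmem : ∀ x ∈ frontier Ω₁, inv x ∈ frontier Ω₀ := fun x hx =>
    h.bijOn.surjOn.mapsTo_invFunOn hx
  have h1 : EqOn g (fun x => ∑ i ∈ s, χ i (inv x) * g x) (frontier Ω₁) := fun x hx => by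
    beta_reduce
    rw [← Finset.sum_mul, hsum _ (hmem x hx), one_mul]
  rw [integral_surface_congr h1, integral_finsetSum]
  swap
  · exact fun i _ => h.target.integrable_of_continuousOn
      (((hχ i).comp_continuousOn hinv).mul hg)
  refine Finset.sum_congr rfl fun i _ => ?_
  have hpatch := h.isImmersedPatch (hψ i)
  obtain ⟨hK, hKW⟩ := (hψ i).isCompact_preimage
    (h.source.isCompact_frontier.inter_right (isClosed_tsupport (χ i)))
    (inter_subset_right.trans (hsupp i)) inter_subset_left
  set K := θ i '' (frontier Ω₀ ∩ tsupport (χ i))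
  have hsub : (fun y => Y (ψ i y)) '' K ⊆ frontier Ω₁ := by
    rintro _ ⟨y, hy, rfl⟩
    exact h.bijOn.mapsTo ((hψ i).mapsTo y (hKW hy)).1
  have h2 : ∫ x, χ i (inv x) * g x ∂surfaceMeasure Ω₁ =
      ∫ x in (fun y => Y (ψ i y)) '' K, χ i (inv x) * g x
        ∂(Measure.euclideanHausdorffMeasure 2 : Measure E3) := by
    refine setIntegral_eq_of_subset_of_forall_sdiff_eq_zero isClosed_frontier.measurableSet
      hsub fun x hx => ?_
    -- A point of the surface whose reference point lies in the support of χᵢ belongs to the image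
    -- of K, so the integrand vanishes off that image.
    have : inv x ∉ tsupport (χ i) := fun hc => hx.2 ⟨θ i (inv x),
      ⟨inv x, ⟨hmem x hx.1, hc⟩, rfl⟩, by
        beta_reduce
        rw [(hψ i).rightInv _ ⟨hmem x hx.1, hsupp i hc⟩]
        exact h.bijOn.surjOn.rightInvOn_invFunOn hx.1⟩
    rw [image_eq_zero_of_notMem_tsupport this, zero_mul]
  rw [h2, hpatch.integral_image hKW hK.measurableSet]
  refine setIntegral_congr_fun hK.measurableSet fun y hy => ?_
  rw [hinvY _ ((hψ i).mapsTo y (hKW hy)).1, smul_eq_mul]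
  ring

namespace IsEvolvingSurface
variable {I : Set ℝ} {Ωref : Set E3} {Ω : ℝ → Set E3} {X : ℝ → E3 → E3} {O : Set E3} {W : Set E2}
  {ψ : E2 → E3} {θ : E3 → E2}

theorem contDiffOn_chart (hS : IsEvolvingSurface I Ωref Ω X)
    (hψ : IsSurfaceChart Ωref O W ψ θ) :
    ContDiffOn ℝ 2 (fun q : ℝ × E2 => X q.1 (ψ q.2)) (I ×ˢ W) :=
  (hS.contDiffOn.of_le ENat.LEInfty.out).comp (contDiff_fst.contDiffOn.prodMk
    (hψ.contDiffOn.comp contDiff_snd.contDiffOn fun _ hq => hq.2))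
    fun q hq => ⟨hq.1, (hψ.mapsTo q.2 hq.2).1⟩

/-- Spatial derivatives at frozen time, and in `velocity_chart` the velocity, are values of a single
joint derivative on I × W. Symmetry of second derivatives can then be applied to it. -/
theorem fderiv_chart (hS : IsEvolvingSurface I Ωref Ω X) (hψ : IsSurfaceChart Ωref O W ψ θ)
    {s : ℝ} (hs : s ∈ I) {y : E2} (hy : y ∈ W) (e : E2) :
    fderiv ℝ (fun y => X s (ψ y)) y e =
      fderivWithin ℝ (fun q : ℝ × E2 => X q.1 (ψ q.2)) (I ×ˢ W) (s, y) (0, e) := by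
  have h1 := ((hS.contDiffOn_chart hψ).differentiableOn (by simp) (s, y) ⟨hs, hy⟩).hasFDerivWithinAt
  have h2 : HasFDerivAt (fun y : E2 => (s, y)) (ContinuousLinearMap.inr ℝ ℝ E2) y :=
    hasFDerivAt_prodMk_right s y
  have h3 := h1.comp_hasFDerivAt y h2
    (Filter.eventually_of_mem (hψ.patch.isOpen.mem_nhds hy) fun z hz => ⟨hs, hz⟩)
  have h4 := congrArg (fun A : E2 →L[ℝ] E3 => A e) h3.fderiv
  exact h4

theorem velocity_chart (hS : IsEvolvingSurface I Ωref Ω X) (hI : UniqueDiffOn ℝ I)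
    (hψ : IsSurfaceChart Ωref O W ψ θ) {s : ℝ} (hs : s ∈ I) {y : E2} (hy : y ∈ W) :
    velocity I Ωref X s (X s (ψ y)) =
      fderivWithin ℝ (fun q : ℝ × E2 => X q.1 (ψ q.2)) (I ×ˢ W) (s, y) (1, 0) := by
  have h1 := ((hS.contDiffOn_chart hψ).differentiableOn (by simp) (s, y) ⟨hs, hy⟩).hasFDerivWithinAt
  have hl : HasDerivWithinAt (fun r : ℝ => (r, y)) ((1 : ℝ), (0 : E2)) I s :=
    (hasDerivWithinAt_id s I).prodMk (hasDerivWithinAt_const s I y)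
  have hm : MapsTo (fun r : ℝ => (r, y)) I (I ×ˢ W) := fun r hr => ⟨hr, hy⟩
  have h2 := h1.comp_hasDerivWithinAt s hl hm
  rw [hS.velocity_apply hs (hψ.mapsTo y hy).1]
  exact h2.derivWithin (hI s hs)

/-- The area element of an evolving surface changes at the rate of the surface divergence of the
velocity. -/
theorem hasDerivWithinAt_areaElement (hS : IsEvolvingSurface I Ωref Ω X) (hI : I.OrdConnected)
    (hI' : I.Nontrivial) (hψ : IsSurfaceChart Ωref O W ψ θ) {t : ℝ} (ht : t ∈ I) {y : E2}
    (hy : y ∈ W) :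
    HasDerivWithinAt (fun s => areaElement (fun y => X s (ψ y)) y)
      (areaElement (fun y => X t (ψ y)) y *
        divP (Ω t) (velocity I Ωref X t) (X t (ψ y))) I t := by
  have hconv : Convex ℝ I := hI.convex
  have hint : (interior I).Nonempty := hconv.nontrivial_iff_nonempty_interior.1 hI'
  have hIu : UniqueDiffOn ℝ I := uniqueDiffOn_convex hconv hint
  have hd := hS.isSurfaceDiffeo ht
  have hpatch := hd.isImmersedPatch hψ
  have hΩ := hS.domain t ht
  have hWy : W ∈ 𝓝 y := hψ.patch.isOpen.mem_nhds hy
  have hx : X t (ψ y) ∈ frontier (Ω t) := hd.bijOn.mapsTo (hψ.mapsTo y hy).1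
  have hmaps : ∀ᶠ z in 𝓝 y, X t (ψ z) ∈ frontier (Ω t) := by
    filter_upwards [hWy] with z hz using hd.bijOn.mapsTo (hψ.mapsTo z hz).1
  set Y : ℝ × E2 → E3 := fun q => X q.1 (ψ q.2)
  set Q : Set (ℝ × E2) := I ×ˢ W
  have hY : ContDiffOn ℝ 2 Y Q := hS.contDiffOn_chart hψ
  have hQ : UniqueDiffOn ℝ Q := hIu.prod hψ.patch.isOpen.uniqueDiffOn
  have hq : (t, y) ∈ Q := ⟨ht, hy⟩
  have hD : HasFDerivWithinAt (fderivWithin ℝ Y Q) (fderivWithin ℝ (fderivWithin ℝ Y Q) Q (t, y))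
      Q (t, y) :=
    ((hY.fderivWithin hQ (m := 1) (by norm_num)).differentiableOn (by simp) _ hq).hasFDerivWithinAt
  -- Symmetry holds at the endpoints of I too, since every point of I × W lies in the closure of its
  -- interior.
  have hsymm : IsSymmSndFDerivWithinAt ℝ Y Q (t, y) := by
    refine (hY _ hq).isSymmSndFDerivWithinAt (by simp) hQ ?_ hq
    rw [interior_prod_eq, closure_prod_eq, hψ.patch.isOpen.interior_eq]
    refine ⟨?_, subset_closure hy⟩
    rw [hconv.closure_interior_eq_closure_of_nonempty_interior hint]
    exact subset_closure ht
  obtain ⟨A, hA⟩ := (hS.contDiffOn_velocity hIu ht).differentiableOn (by simp) _ hx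
  -- mixed derivatives of the parametrization are derivatives of the velocity
  have hmix : ∀ e, fderivWithin ℝ (fderivWithin ℝ Y Q) Q (t, y) (0, e) (1, 0) =
      A (fderiv ℝ (fun y => X t (ψ y)) y e) := by
    intro e
    have hl : HasFDerivAt (fun z : E2 => (t, z)) (ContinuousLinearMap.inr ℝ ℝ E2) y :=
      hasFDerivAt_prodMk_right t y
    have h1 := hD.comp_hasFDerivAt y hl
      (Filter.eventually_of_mem hWy fun z hz => ⟨ht, hz⟩)
    have h2 : HasFDerivAt (fun z => fderivWithin ℝ Y Q (t, z) (1, 0)) _ y :=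
      (ContinuousLinearMap.apply ℝ E3 ((1 : ℝ), (0 : E2))).hasFDerivAt.comp y h1
    have h3 : HasFDerivAt (fun z => velocity I Ωref X t (X t (ψ z)))
        (A.comp (fderiv ℝ (fun y => X t (ψ y)) y)) y :=
      HasFDerivWithinAt.comp_hasFDerivAt (f := fun z => X t (ψ z)) y hA
        (hpatch.hasStrictFDerivAt hy).hasFDerivAt hmaps
    have h4 : (fun z => velocity I Ωref X t (X t (ψ z))) =ᶠ[𝓝 y]
        fun z => fderivWithin ℝ Y Q (t, z) (1, 0) := by
      filter_upwards [hWy] with z hz using hS.velocity_chart hIu hψ ht hz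
    exact congrArg (fun B : E2 →L[ℝ] E3 => B e) (h2.unique (h3.congr_of_eventuallyEq h4.symm))
  have hvec : ∀ e, HasDerivWithinAt (fun s => fderivWithin ℝ Y Q (s, y) (0, e))
      (A (fderiv ℝ (fun y => X t (ψ y)) y e)) I t := by
    intro e
    have hl : HasDerivWithinAt (fun r : ℝ => (r, y)) ((1 : ℝ), (0 : E2)) I t :=
      (hasDerivWithinAt_id t I).prodMk (hasDerivWithinAt_const t I y)
    have hm : MapsTo (fun r : ℝ => (r, y)) I Q := fun r hr => ⟨hr, hy⟩
    have h1 := hD.comp_hasDerivWithinAt t hl hm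
    have h2 := (ContinuousLinearMap.apply ℝ E3 ((0 : ℝ), e)).hasFDerivAt.comp_hasDerivWithinAt t h1
    rw [← hmix, hsymm]
    exact h2
  have hJ : ∀ s ∈ I, areaElement (fun y => X s (ψ y)) y =
      ‖crossL (fderivWithin ℝ Y Q (s, y) (0, EuclideanSpace.single 0 1))
        (fderivWithin ℝ Y Q (s, y) (0, EuclideanSpace.single 1 1))‖ := fun s hs => by
    rw [areaElement_eq, hS.fderiv_chart hψ hs hy, hS.fderiv_chart hψ hs hy]
  have hJpos := hpatch.areaElement_pos hy
  have hder := HasDerivWithinAt.norm_crossL (hvec (EuclideanSpace.single 0 1))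
    (hvec (EuclideanSpace.single 1 1)) (by rw [← norm_pos_iff, ← hJ t ht]; exact hJpos)
  refine (hder.congr hJ (hJ t ht)).congr_deriv ?_
  have ht' : ∀ e, ⟪fderiv ℝ (fun y => X t (ψ y)) y e, normal (Ω t) (X t (ψ y))⟫ = 0 := fun e =>
    hΩ.inner_normal_of_hasFDerivAt (hpatch.hasStrictFDerivAt hy).hasFDerivAt hmaps e
  have key := inner_crossL_map_add_eq_tr (hΩ.norm_normal hx) A (ht' (EuclideanSpace.single 0 1))
    (ht' (EuclideanSpace.single 1 1))
  rw [← hΩ.divP_eq hx hA] at key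
  rw [← hJ t ht]
  simp only [← hS.fderiv_chart hψ ht hy, Y, Q]
  rw [key, ← areaElement_eq]
  field_simp

end IsEvolvingSurface

namespace IsEvolvingSurface
variable {I : Set ℝ} {Ωref : Set E3} {Ω : ℝ → Set E3} {X : ℝ → E3 → E3}

/-- The function is the time derivative of the area element, which is jointly C¹ because it is the
norm of a nonvanishing C¹ cross product. No joint regularity of the normal or of the inverse
parametrization is needed. -/
theorem continuousOn_areaElement_mul_divP {O : Set E3} {W : Set E2} {ψ : E2 → E3} {θ : E3 → E2}
    (hS : IsEvolvingSurface I Ωref Ω X) (hI : I.OrdConnected)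
    (hI' : I.Nontrivial) (hψ : IsSurfaceChart Ωref O W ψ θ) :
    ContinuousOn (fun q : ℝ × E2 => areaElement (fun y => X q.1 (ψ y)) q.2 *
      divP (Ω q.1) (velocity I Ωref X q.1) (X q.1 (ψ q.2))) (I ×ˢ W) := by
  have hconv : Convex ℝ I := hI.convex
  have hIu : UniqueDiffOn ℝ I :=
    uniqueDiffOn_convex hconv (hconv.nontrivial_iff_nonempty_interior.1 hI')
  have hQ : UniqueDiffOn ℝ (I ×ˢ W) := hIu.prod hψ.patch.isOpen.uniqueDiffOn
  have hpos : ∀ q ∈ I ×ˢ W, 0 < areaElement (fun y => X q.1 (ψ y)) q.2 := fun q hq =>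
    ((hS.isSurfaceDiffeo hq.1).isImmersedPatch hψ).areaElement_pos hq.2
  have hD : ∀ e : E2, ContDiffOn ℝ 1 (fun q => fderivWithin ℝ
      (fun q : ℝ × E2 => X q.1 (ψ q.2)) (I ×ˢ W) q (0, e)) (I ×ˢ W) := fun e =>
    ((hS.contDiffOn_chart hψ).fderivWithin hQ (by norm_num)).clm_apply contDiffOn_const
  have hcross := (crossL.contDiff.comp_contDiffOn (hD (EuclideanSpace.single 0 1))).clm_apply
    (hD (EuclideanSpace.single 1 1))
  have heq : ∀ q ∈ I ×ˢ W, areaElement (fun y => X q.1 (ψ y)) q.2 = _ := fun q hq => by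
    rw [areaElement_eq, hS.fderiv_chart hψ hq.1 hq.2, hS.fderiv_chart hψ hq.1 hq.2]
  have hj : ContDiffOn ℝ 1 (fun q : ℝ × E2 => areaElement (fun y => X q.1 (ψ y)) q.2)
      (I ×ˢ W) := by
    refine (hcross.norm ℝ fun q hq => ?_).congr heq
    have := hpos q hq
    rw [heq q hq] at this
    exact norm_pos_iff.1 this
  have hc := (hj.continuousOn_fderivWithin hQ le_rfl).clm_apply
    (continuousOn_const (c := ((1 : ℝ), (0 : E2))))
  refine hc.congr fun q hq => ?_
  have hl : HasDerivWithinAt (fun r : ℝ => (r, q.2)) ((1 : ℝ), (0 : E2)) I q.1 :=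
    (hasDerivWithinAt_id q.1 I).prodMk (hasDerivWithinAt_const q.1 I q.2)
  have hm : MapsTo (fun r : ℝ => (r, q.2)) I (I ×ˢ W) := fun r hr => ⟨hr, hq.2⟩
  have h1 := (hj.differentiableOn (by simp) q hq).hasFDerivWithinAt.comp_hasDerivWithinAt q.1 hl hm
  exact (hIu q.1 hq.1).eq_deriv I (hS.hasDerivWithinAt_areaElement hI hI' hψ hq.1 hq.2) h1

/-- **First variation of area.** -/
theorem hasDerivWithinAt_area (hS : IsEvolvingSurface I Ωref Ω X) (hI : I.OrdConnected)
    (hI' : I.Nontrivial) {t : ℝ} (ht : t ∈ I) :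
    HasDerivWithinAt (fun s => (area (Ω s)).toReal)
      (∫ x, divP (Ω t) (velocity I Ωref X t) x ∂surfaceMeasure (Ω t)) I t := by
  have hconv : Convex ℝ I := hI.convex
  have hIu : UniqueDiffOn ℝ I :=
    uniqueDiffOn_convex hconv (hconv.nontrivial_iff_nonempty_interior.1 hI')
  choose O W ψ θ hxO hch using fun x : frontier Ωref => hS.reference.exists_surfaceChart x.2
  obtain ⟨T, χ, hχ, hsupp, hsum⟩ := exists_finite_partition hS.reference.isCompact_frontier
    (fun x => (hch x).isOpen_target) hxO
  have harea : ∀ s ∈ I, (area (Ω s)).toReal = _ := fun s hs =>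
    (show (area (Ω s)).toReal = ∫ _, (1 : ℝ) ∂surfaceMeasure (Ω s) by
      simp [area, Measure.real]).trans
    ((hS.isSurfaceDiffeo hs).integral_eq_sum (fun i => (hχ i).continuous) hsum hch hsupp
      (g := fun _ => 1) continuousOn_const)
  rw [(hS.isSurfaceDiffeo ht).integral_eq_sum (fun i => (hχ i).continuous) hsum hch hsupp
    ((hS.domain t ht).continuousOn_divP (hS.contDiffOn_velocity hIu ht))]
  -- The partition of unity lives on the reference surface, so weights and domains of integration do
  -- not depend on time; only the area element is differentiated.
  refine HasDerivWithinAt.congr (HasDerivWithinAt.fun_sum fun i _ => ?_) harea (harea t ht)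
  obtain ⟨hK, hKW⟩ := (hch i).isCompact_preimage
    (hS.reference.isCompact_frontier.inter_right (isClosed_tsupport (χ i)))
    (inter_subset_right.trans (hsupp i)) inter_subset_left
  have hχψ : ContinuousOn (fun y => χ i (ψ i y)) (W i) :=
    (hχ i).continuous.comp_continuousOn (hch i).contDiffOn.continuousOn
  refine hasDerivWithinAt_setIntegral hI (hch i).patch.isOpen hK hKW
    (J := fun s y => χ i (ψ i y) * (areaElement (fun y => X s (ψ i y)) y * 1))
    (J' := fun s y => χ i (ψ i y) * (areaElement (fun y => X s (ψ i y)) y *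
      divP (Ω s) (velocity I Ωref X s) (X s (ψ i y)))) ?_ ?_ ?_ ht
  · exact fun s hs => hχψ.mul
      (((hS.isSurfaceDiffeo hs).isImmersedPatch (hch i)).continuousOn_areaElement.mul
        continuousOn_const)
  · intro s hs y hy
    simp only [mul_one]
    exact (hS.hasDerivWithinAt_areaElement hI hI' (hch i) hs hy).const_mul _
  · exact (hχψ.comp continuous_snd.continuousOn fun q hq => hq.2).mul
      (hS.continuousOn_areaElement_mul_divP hI hI' (hch i))

end IsEvolvingSurface

end ClosedSurface

end

/-! ### The constraint and conservation of area -/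

theorem mainTheorem1
    {I : Set ℝ} (hI : I.OrdConnected) (hI' : I.Nontrivial)
    {Ωref : Set E3} {Ω : ℝ → Set E3} {X : ℝ → E3 → E3}
    (hS : ClosedSurface.IsEvolvingSurface I Ωref Ω X)
    (V : ℝ → E3 → ℝ) (u : ℝ → E3 → E3) :
    -- at every time, an inextensible velocity with normal component `V` forces the constraint
    (∀ t ∈ I, ClosedSurface.IsInextensibleVelocity (Ω t) (V t) (u t) →
      Integrable (fun x => V t x * ClosedSurface.meanCurvature (Ω t) x)
        (ClosedSurface.surfaceMeasure (Ω t)) ∧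
      Integrable (ClosedSurface.divS (Ω t) (ClosedSurface.tangentialPart (Ω t) (u t)))
        (ClosedSurface.surfaceMeasure (Ω t)) ∧
      0 = ∫ x, ClosedSurface.divP (Ω t) (u t) x ∂ClosedSurface.surfaceMeasure (Ω t) ∧
      ∫ x, ClosedSurface.divP (Ω t) (u t) x ∂ClosedSurface.surfaceMeasure (Ω t) =
        ∫ x, (ClosedSurface.divS (Ω t) (ClosedSurface.tangentialPart (Ω t) (u t)) x
          - V t x * ClosedSurface.meanCurvature (Ω t) x) ∂ClosedSurface.surfaceMeasure (Ω t) ∧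
      ∫ x, (ClosedSurface.divS (Ω t) (ClosedSurface.tangentialPart (Ω t) (u t)) x
          - V t x * ClosedSurface.meanCurvature (Ω t) x) ∂ClosedSurface.surfaceMeasure (Ω t) =
        -∫ x, V t x * ClosedSurface.meanCurvature (Ω t) x ∂ClosedSurface.surfaceMeasure (Ω t) ∧
      V t ∈ {v : E3 → ℝ | ClosedSurface.MemH1 (Ω t) v ∧
        ∫ x, v x * ClosedSurface.meanCurvature (Ω t) x
          ∂ClosedSurface.surfaceMeasure (Ω t) = 0}) ∧
    -- if the surface moves with normal velocity `V`, the constraint is conservation of total area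
    (ClosedSurface.HasNormalVelocity I Ωref Ω X V →
      (∀ t ∈ I, ClosedSurface.area (Ω t) < ⊤ ∧
        Integrable (fun x => V t x * ClosedSurface.meanCurvature (Ω t) x)
          (ClosedSurface.surfaceMeasure (Ω t)) ∧
        HasDerivWithinAt (fun s => (ClosedSurface.area (Ω s)).toReal)
          (-∫ x, V t x * ClosedSurface.meanCurvature (Ω t) x
            ∂ClosedSurface.surfaceMeasure (Ω t)) I t) ∧
      ((∀ t ∈ I, ClosedSurface.IsInextensibleVelocity (Ω t) (V t) (u t)) →
        ∀ s ∈ I, ∀ t ∈ I, ClosedSurface.area (Ω s) = ClosedSurface.area (Ω t))) := by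
  have hconv : Convex ℝ I := hI.convex
  have hIu : UniqueDiffOn ℝ I :=
    uniqueDiffOn_convex hconv (hconv.nontrivial_iff_nonempty_interior.1 hI')
  refine ⟨fun t ht h => ?_, fun hV => ?_⟩
  · have hΩ := hS.domain t ht
    obtain ⟨h1, h2, h3, h4⟩ := hΩ.integral_divP h.contDiffOn h.inner_normal
    exact ⟨h1, h2, h.integral_divP_eq_zero.symm, h3, h4, h.memH1 hΩ,
      h.integral_mul_meanCurvature_eq_zero hΩ⟩
  · have hfin : ∀ t ∈ I, ClosedSurface.area (Ω t) < ⊤ := fun t ht =>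
      (hS.domain t ht).isFiniteMeasure.measure_univ_lt_top
    have hder : ∀ t ∈ I, HasDerivWithinAt (fun s => (ClosedSurface.area (Ω s)).toReal)
        (-∫ x, V t x * ClosedSurface.meanCurvature (Ω t) x
          ∂ClosedSurface.surfaceMeasure (Ω t)) I t := fun t ht => by
      -- The integral identity is applied to the actual velocity of the surface, not to u. The two
      -- may differ tangentially, but only the normal component V enters.
      obtain ⟨-, -, h3, h4⟩ := (hS.domain t ht).integral_divP (hS.contDiffOn_velocity hIu ht)
        (hS.inner_velocity_normal hV ht)
      rw [← h4, ← h3]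
      exact hS.hasDerivWithinAt_area hI hI' ht
    refine ⟨fun t ht => ⟨hfin t ht, ((hS.domain t ht).integral_divP
      (hS.contDiffOn_velocity hIu ht) (hS.inner_velocity_normal hV ht)).1, hder t ht⟩,
      fun hu s hs t ht => ?_⟩
    -- Finite areas may be compared as real numbers, and a real function with zero derivative on a
    -- convex set is constant.
    rw [← ENNReal.toReal_eq_toReal_iff' (hfin s hs).ne (hfin t ht).ne]
    refine hconv.is_const_of_fderivWithin_eq_zero (𝕜 := ℝ)
      (f := fun s => (ClosedSurface.area (Ω s)).toReal)
      (fun r hr => (hder r hr).differentiableWithinAt) (fun r hr => ?_) hs ht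
    have h0 := hder r hr
    rw [(hu r hr).integral_mul_meanCurvature_eq_zero (hS.domain r hr), neg_zero] at h0
    rw [h0.hasFDerivWithinAt.fderivWithin (hIu r hr)]
    ext
    simp
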